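/- **Setting.** All functions are real valued, $\|f\|_K=\sup_{x\in K}|f(x)|$ (and $\|f\|_\emptyset=0$), and $\mathbb B(x,r)$ denotes the closed ball. *Data spaces.* A (compact) data space $\Xi=(\mathbb X,d,\mu^*,\{\lambda_k\}_{k\ge0},\{\phi_k\}_{k\ge0})$ consists of a compact metric space $(\mathbb X,d)$, a Borel probability measure $\mu^*$, a non-decreasing sequence $0=\lambda_0\le\lambda_1\le\cdots\to\infty$, and continuous functions $\phi_k$, orthonormal in $L^2(\mu^*)$, such that for some $q\ge1$ and $\kappa,\kappa_1,\kappa_2>0$: $\mu^*(\mathbb B(x,r))=\mu^*(\{y:d(x,y)<r\})\le\kappa r^q$ for all $x\in\mathbb X$, $r>0$; and for all $x,y\in\mathbb X$, $0<t\le1$, the series $\sum_k e^{-\lambda_k^2t}\phi_k(x)\phi_k(y)$ converges and is bounded in absolute value by $\kappa_1t^{-q/2}\exp(-\kappa_2d(x,y)^2/t)$. Let $\Pi_n(\Xi)=\mathrm{span}\{\phi_k:\lambda_k<n\}$ and $E_n(f)=\min_{P\in\Pi_n}\|f-P\|_{\mathbb X}$. For $\gamma>0$, $W_\gamma(\Xi)$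 is the set of $f\in C(\mathbb X)$ with $\sup_{n>0}n^\gamma E_n(f)<\infty$; $C^\infty=\bigcap_{\gamma>0}W_\gamma$; $C^\infty(B)$ is the set of functions in $C^\infty$ supported on $B$; $W_\gamma(\Xi;A)$ is the set of $f\in C(\mathbb X)$ such that for every $x_0\in A$ there is $\rho>0$ with $\psi f\in W_\gamma(\Xi)$ for all $\psi\in C^\infty(\mathbb B(x_0,\rho))$. $\mathbb X$ *has a partition of unity* if for every $\rho>0$ there is a sequence $\psi_k\in C^\infty$, $0\le\psi_k\le1$, each supported on some ball of radius $\rho$, and an integer $N$, such that for every $x\in\mathbb X$ there is a set $F_x$ of at most $N$ indices with $\sum_{k\in F_x}\psi_k(y)=1$ for all $y\in\mathbb B(x,\rho)$. $\Xi$ satisfies the *strong product assumption* if for some $A^*\ge1$ and all integers $n\ge1$, $P,R\in\Pi_n$ implies $PR\in\Pi_{A^*n}$. Fix an even $C^\infty$ function $h:\mathbb R\to[0,1]$ with $h=1$ on $[0,1/2]$ and $h=0$ on $[1,\infty)$. For real $n>0$ put $\sigma_n(\Xi;f)(x)=\int_{\mathbb X}\sum_kh(\lambda_k/n)\phi_k(x)\phi_k(y)f(y)\,d\mu^*(y)$.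 *Joint data spaces.* Let $\Xi_m=(\mathbb X_m,d_m,\mu_m^*,\{\lambda_{m,k}\},\{\phi_{m,k}\})$, $m=1,2$, be data spaces; let $d_{1,2}:\mathbb X_1\times\mathbb X_2\to[0,\infty)$ satisfy $d_{1,2}(x_1,x_2)\le d_1(x_1,x_1')+d_{1,2}(x_1',x_2)$ and $d_{1,2}(x_1,x_2)\le d_{1,2}(x_1,x_2')+d_2(x_2',x_2)$; let $\mathbf A=(A_{j,k})_{j,k\ge0}$ be real and $\mathbf L=(\ell_{j,k})_{j,k\ge0}$ be nonnegative with $\{(j,k):\ell_{j,k}<u\}$ finite for every $u>0$. Then $(\Xi_1,\Xi_2,d_{1,2},\mathbf A,\mathbf L)$ is a *joint data space with exponents* $(Q,q_1,q_2)$, where $Q,q_1,q_2>0$, if for some positive constants $c,c_0,c_1,c_2$ and all $x_1\in\mathbb X_1$, $x_2\in\mathbb X_2$: (i) $\mu_1^*(\{z:d_{1,2}(z,x_2)\le\rho\})\le c\rho^{q_1}$ and $\mu_2^*(\{z:d_{1,2}(x_1,z)\le\rho\})\le c\rho^{q_2}$ for all $\rho>0$; (ii) $\sum_{\ell_{j,k}<n}|A_{j,k}\phi_{1,j}(x_1)\phi_{2,k}(x_2)|\le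 cn^Q$ for all integers $n\ge1$; (iii) for $0<t\le1$, $\lim_{n\to\infty}\sum_{\ell_{j,k}<n}e^{-\ell_{j,k}^2t}A_{j,k}\phi_{1,j}(x_1)\phi_{2,k}(x_2)$ exists and is bounded in absolute value by $c_1t^{-c_0}\exp(-c_2d_{1,2}(x_1,x_2)^2/t)$. For $f\in C(\mathbb X_2)$ and real $n>0$ put $\sigma_n(\Xi_1,\Xi_2;f)(x_1)=\int_{\mathbb X_2}f(x_2)\sum_{j,k}h(\ell_{j,k}/n)A_{j,k}\phi_{1,j}(x_1)\phi_{2,k}(x_2)\,d\mu_2^*(x_2)$ and $\mathcal E(f)(x_1)=\lim_{n\to\infty}\sigma_n(\Xi_1,\Xi_2;f)(x_1)$ wherever the limit exists. The *polynomial preservation condition* holds with parameter $c^*>0$ if for every integer $n\ge1$, every $P\in\Pi_n(\Xi_2)$ and every real $m\ge c^*n$, $\sigma_m(\Xi_1,\Xi_2;P)=\sigma_{c^*n}(\Xi_1,\Xi_2;P)$. For $r,s>0$ and compact $A\subseteq\mathbb X_2$, an *image set* $B=\mathcal I(r,s;A)$ is a set $\bigcup_{x\in B^-}\mathbb B(x,s)$,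 where $B^-$ is a compact subset of $\{x_1\in\mathbb X_1:d_{1,2}(x_1,\mathbb X_2\setminus A)\ge s+r\}$ (the distance to the empty set being $\infty$). **Theorem.** Let $(\Xi_1,\Xi_2,d_{1,2},\mathbf A,\mathbf L)$ be a joint data space with exponents $(Q,q_1,q_2)$ that satisfies the polynomial preservation condition with parameter $c^*$, suppose that $\mathbb X_2$ has a partition of unity, and let $S>\max(Q,q_1,q_2)+1$ be an integer. There is a constant $C>0$, depending only on the joint data space and its exponents, $h$, $S$ and $c^*$, such that the following holds for all $r,s>0$, all compact $A\subseteq\mathbb X_2$, all image sets $B=\mathcal I(r,s;A)$, and all $f\in C(\mathbb X_2)$ with $$\sum_{m=0}^\infty2^{m(Q-q_2)}\|\sigma_{2^{m+1}}(\Xi_2;f)-\sigma_{2^m}(\Xi_2;f)\|_A<\infty.$$ (a) $\mathcal E(f)$ exists on $B$, the limit being uniform on $B$, and for every integer $n\ge0$ with $c^*r2^n\ge1$, $$\|\mathcal E(f)-\sigma_{c^*2^n}(\Xi_1,\Xi_2;f)\|_B\le C\Big\{2^{n(Q-q_2)}\|f-\sigma_{2^n}(\Xi_2;f)\|_A+\|f\|_{\mathbb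 X_2}2^{n(Q-S)}r^{q_2-S}+\sum_{m=n}^\infty2^{m(Q-q_2)}\|\sigma_{2^{m+1}}(\Xi_2;f)-\sigma_{2^m}(\Xi_2;f)\|_A\Big\}.$$ In addition, if $\alpha>0$ and $\alpha\ell_{j,k}\ge\lambda_{1,j}$ for all $j,k$, then $\sigma_n(\Xi_1,\Xi_2;f)\in\Pi_{\alpha n}(\Xi_1)$ for all real $n>0$. (b) If moreover $f\in W_\gamma(\Xi_2;A)$ for some $\gamma>0$ with $Q-q_2<\gamma<S-q_2$, then $\mathcal E(f)$ is continuous on $B$. If, further, $\Xi_1$ satisfies the strong product assumption, $\mathbb X_1$ has a partition of unity, and there is $\alpha>0$ with $\alpha\ell_{j,k}\ge\lambda_{1,j}$ for all $j,k$, then for every $\phi\in C^\infty(B)$ the function $\phi\,\mathcal E(f)$ (extended by $0$ outside $B$) belongs to $W_{\gamma-Q+q_2}(\Xi_1)$. -/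

import Mathlib

open Filter Topology MeasureTheory Set

noncomputable section

/-- A fixed low pass filter `h : [0,∞) → [0,1]`, infinitely differentiable, equal to `1` on
`[0,1/2]` and to `0` on `[1,∞)`, extended to `ℝ` as an even function. -/
structure IsLowPassFilter (h : ℝ → ℝ) : Prop where
  smooth : ContDiff ℝ ((⊤ : ℕ∞) : WithTop ℕ∞) h
  even : ∀ t, h (-t) = h t
  mem_unit : ∀ t, h t ∈ Icc (0 : ℝ) 1
  eq_one : ∀ t, 0 ≤ t → t ≤ 1 / 2 → h t = 1
  eq_zero : ∀ t, 1 ≤ t → h t = 0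

/-- The supremum norm of `f` on the set `K` (it is `0` when `K` is empty). It is only applied to
functions that are bounded on `K`. -/
def supNormOn {X : Type*} (K : Set X) (f : X → ℝ) : ℝ := ⨆ x : K, |f x|

/-- A compact data space on the compact metric space `X`. (Closed balls are compact since
`X` is.) -/
structure DataSpace (X : Type*) [MetricSpace X] [CompactSpace X] [MeasurableSpace X]
    [BorelSpace X] where
  /-- the probability measure -/
  μ : Measure X
  isProb : IsProbabilityMeasure μ
  /-- the sequence `λ_k` -/
  lam : ℕ → ℝ
  lam_mono : Monotone lam
  lam_zero : lam 0 = 0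
  lam_tendsto : Tendsto lam atTop atTop
  /-- the continuous functions `φ_k` -/
  phi : ℕ → C(X, ℝ)
  orthonormal : ∀ j k, ∫ x, phi j x * phi k x ∂μ = if j = k then 1 else 0
  /-- ball measure condition and Gaussian upper bound, with a common exponent `q` -/
  exists_exponent : ∃ q κ κ₁ κ₂ : ℝ, 1 ≤ q ∧ 0 < κ ∧ 0 < κ₁ ∧ 0 < κ₂ ∧
    (∀ x : X, ∀ r : ℝ, 0 < r →
      μ.real (Metric.closedBall x r) = μ.real (Metric.ball x r) ∧
      μ.real (Metric.closedBall x r) ≤ κ * r ^ q) ∧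
    (∀ x y : X, ∀ t : ℝ, 0 < t → t ≤ 1 →
      Summable (fun k => Real.exp (-(lam k ^ 2 * t)) * phi k x * phi k y) ∧
      |∑' k, Real.exp (-(lam k ^ 2 * t)) * phi k x * phi k y| ≤
        κ₁ * t ^ (-q / 2) * Real.exp (-(κ₂ * (dist x y ^ 2 / t))))

namespace DataSpace

variable {X : Type*} [MetricSpace X] [CompactSpace X] [MeasurableSpace X] [BorelSpace X]

/-- The space `Π_n = span {φ_k : λ_k < n}` of diffusion polynomials of order `< n`. -/
def diffPoly (D : DataSpace X) (n : ℝ) : Submodule ℝ C(X, ℝ) :=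
  Submodule.span ℝ (D.phi '' {k | D.lam k < n})

/-- The degree of uniform approximation `E_n(f) = inf {‖f - P‖ : P ∈ Π_n}`. -/
def degApprox (D : DataSpace X) (n : ℝ) (f : C(X, ℝ)) : ℝ :=
  Metric.infDist f (D.diffPoly n : Set C(X, ℝ))

/-- The global smoothness class `W_γ` (uniform norm): `sup_{n > 0} n ^ γ E_n(f) < ∞`. -/
def W (D : DataSpace X) (γ : ℝ) : Set C(X, ℝ) :=
  {f | BddAbove ((fun n : ℝ => n ^ γ * D.degApprox n f) '' Ioi 0)}

/-- The class `C^∞`, the intersection of all `W_γ`, `γ > 0`. -/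
def smooth (D : DataSpace X) : Set C(X, ℝ) := {f | ∀ γ : ℝ, 0 < γ → f ∈ D.W γ}

/-- `C^∞(B)`: the functions in `C^∞` that vanish outside `B`. (For closed `B`, the only case used,
this is the same as the closed support being contained in `B`.) -/
def smoothOn (D : DataSpace X) (B : Set X) : Set C(X, ℝ) :=
  {f | f ∈ D.smooth ∧ Function.support f ⊆ B}

/-- The local smoothness class `W_γ(x₀)` at a point. -/
def WAt (D : DataSpace X) (γ : ℝ) (x₀ : X) : Set C(X, ℝ) :=
  {f | ∃ r : ℝ, 0 < r ∧ ∀ φ ∈ D.smoothOn (Metric.closedBall x₀ r), φ * f ∈ D.W γ}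

/-- The local smoothness class `W_γ(A)` on a set. -/
def WOn (D : DataSpace X) (γ : ℝ) (A : Set X) : Set C(X, ℝ) := {f | ∀ x₀ ∈ A, f ∈ D.WAt γ x₀}

/-- The kernel `Φ_n(x,y) = ∑_m h(λ_m / n) φ_m(x) φ_m(y)`; for `n > 0` a finite sum. -/
def kernel (D : DataSpace X) (h : ℝ → ℝ) (n : ℝ) (x y : X) : ℝ :=
  ∑' m, h (D.lam m / n) * D.phi m x * D.phi m y

/-- The operator `σ_n(f)(x) = ∫ Φ_n(x,y) f(y) dμ(y)`. -/
def sigma (D : DataSpace X) (h : ℝ → ℝ) (n : ℝ) (f : C(X, ℝ)) (x : X) : ℝ :=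
  ∫ y, D.kernel h n x y * f y ∂D.μ

/-- `X` has a partition of unity: for each radius `r` a countable family of `C^∞` functions with
values in `[0,1]`, each supported in a ball of radius `r`, such that on each ball `𝔹(x,r)` a
subfamily of uniformly bounded cardinality sums to `1`. -/
def HasPartitionOfUnity (D : DataSpace X) : Prop :=
  ∀ r : ℝ, 0 < r → ∃ ψ : ℕ → C(X, ℝ),
    (∀ k, ψ k ∈ D.smooth) ∧
    (∀ k, ∃ z : X, Function.support (ψ k) ⊆ Metric.closedBall z r) ∧
    (∀ k x, 0 ≤ ψ k x ∧ ψ k x ≤ 1) ∧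
    ∃ N : ℕ, ∀ x : X, ∃ F : Finset ℕ, F.card ≤ N ∧
      ∀ y ∈ Metric.closedBall x r, ∑ k ∈ F, ψ k y = 1

/-- The strong product assumption: products of elements of `Π_n` lie in `Π_{a n}`. -/
def StrongProduct (D : DataSpace X) : Prop :=
  ∃ a : ℝ, 1 ≤ a ∧ ∀ n : ℕ, 0 < n → ∀ P ∈ D.diffPoly n, ∀ R ∈ D.diffPoly n,
    P * R ∈ D.diffPoly (a * n)

end DataSpace

/-- The data `(Ξ₁, Ξ₂, d₁₂, 𝐀, 𝐋)` of a joint data space: two compact data spaces, a joint distance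
satisfying the generalized triangle inequalities, connection coefficients `A_{j,k}` and joint
eigenvalues `ℓ_{j,k} ≥ 0` such that `{(j,k) : ℓ_{j,k} < u}` is finite for each `u > 0`. -/
structure JointData (X₁ X₂ : Type*)
    [MetricSpace X₁] [CompactSpace X₁] [MeasurableSpace X₁] [BorelSpace X₁]
    [MetricSpace X₂] [CompactSpace X₂] [MeasurableSpace X₂] [BorelSpace X₂] where
  Ξ₁ : DataSpace X₁
  Ξ₂ : DataSpace X₂
  /-- the joint distance -/
  d : X₁ → X₂ → ℝ
  d_nonneg : ∀ x₁ x₂, 0 ≤ d x₁ x₂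
  d_triangle_left : ∀ x₁ x₁' x₂, d x₁ x₂ ≤ dist x₁ x₁' + d x₁' x₂
  d_triangle_right : ∀ x₁ x₂ x₂', d x₁ x₂ ≤ d x₁ x₂' + dist x₂' x₂
  /-- the connection coefficients -/
  A : ℕ → ℕ → ℝ
  /-- the joint eigenvalues -/
  L : ℕ → ℕ → ℝ
  L_nonneg : ∀ j k, 0 ≤ L j k
  L_finite : ∀ u : ℝ, 0 < u → {p : ℕ × ℕ | L p.1 p.2 < u}.Finite

namespace JointData

variable {X₁ X₂ : Type*}
  [MetricSpace X₁] [CompactSpace X₁] [MeasurableSpace X₁] [BorelSpace X₁]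
  [MetricSpace X₂] [CompactSpace X₂] [MeasurableSpace X₂] [BorelSpace X₂]

/-- The data form a joint data space with exponents `(Q, q₁, q₂)`: joint regularity, variation
bound, and joint Gaussian upper bound (which includes the existence of the limit that defines the
joint heat kernel). -/
structure IsJointDataSpace (J : JointData X₁ X₂) (Q q₁ q₂ : ℝ) : Prop where
  Q_pos : 0 < Q
  q₁_pos : 0 < q₁
  q₂_pos : 0 < q₂
  regularity : ∃ c : ℝ, 0 < c ∧ ∀ r : ℝ, 0 < r →
    (∀ x₂, J.Ξ₁.μ.real {z | J.d z x₂ ≤ r} ≤ c * r ^ q₁) ∧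
    (∀ x₁, J.Ξ₂.μ.real {z | J.d x₁ z ≤ r} ≤ c * r ^ q₂)
  variation : ∃ c : ℝ, 0 < c ∧ ∀ n : ℕ, 0 < n → ∀ x₁ x₂,
    (∑ᶠ (p : ℕ × ℕ) (_ : J.L p.1 p.2 < n),
      |J.A p.1 p.2 * J.Ξ₁.phi p.1 x₁ * J.Ξ₂.phi p.2 x₂|) ≤ c * (n : ℝ) ^ Q
  gaussian : ∃ c₀ c₁ c₂ : ℝ, 0 < c₀ ∧ 0 < c₁ ∧ 0 < c₂ ∧
    ∀ x₁ x₂, ∀ t : ℝ, 0 < t → t ≤ 1 → ∃ K : ℝ,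
      Tendsto (fun n : ℝ => ∑ᶠ (p : ℕ × ℕ) (_ : J.L p.1 p.2 < n),
        Real.exp (-(J.L p.1 p.2 ^ 2 * t)) * J.A p.1 p.2 *
          J.Ξ₁.phi p.1 x₁ * J.Ξ₂.phi p.2 x₂) atTop (𝓝 K) ∧
      |K| ≤ c₁ * t ^ (-c₀) * Real.exp (-(c₂ * (J.d x₁ x₂ ^ 2 / t)))

/-- The joint kernel `Φ_n(x₁,x₂) = ∑_{j,k} h(ℓ_{j,k} / n) A_{j,k} φ_{1,j}(x₁) φ_{2,k}(x₂)`;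
for `n > 0` a finite sum. -/
def kernel (J : JointData X₁ X₂) (h : ℝ → ℝ) (n : ℝ) (x₁ : X₁) (x₂ : X₂) : ℝ :=
  ∑' p : ℕ × ℕ, h (J.L p.1 p.2 / n) * J.A p.1 p.2 * J.Ξ₁.phi p.1 x₁ * J.Ξ₂.phi p.2 x₂

/-- The joint operator `σ_n(Ξ₁,Ξ₂;f)(x₁) = ∫ f(x₂) Φ_n(x₁,x₂) dμ₂(x₂)`. -/
def sigma (J : JointData X₁ X₂) (h : ℝ → ℝ) (n : ℝ) (f : C(X₂, ℝ)) (x₁ : X₁) : ℝ :=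
  ∫ x₂, f x₂ * J.kernel h n x₁ x₂ ∂J.Ξ₂.μ

/-- The polynomial preservation condition with parameter `c`. -/
def PolynomialPreservation (J : JointData X₁ X₂) (h : ℝ → ℝ) (c : ℝ) : Prop :=
  0 < c ∧ ∀ n : ℕ, 0 < n → ∀ P ∈ J.Ξ₂.diffPoly n, ∀ m : ℝ, c * n ≤ m →
    J.sigma h m P = J.sigma h (c * n) P

/-- The lifted function `ℰ(f) = lim_{n → ∞} σ_n(Ξ₁,Ξ₂;f)`; its value at a point is meaningful only
if the limit exists there. -/
def lift (J : JointData X₁ X₂) (h : ℝ → ℝ) (f : C(X₂, ℝ)) (x₁ : X₁) : ℝ :=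
  limUnder atTop (fun n : ℝ => J.sigma h n f x₁)

/-- The distance `d₁₂(x₁, A₂)` from a point to a set, the infimum over the empty set being `∞`. -/
def distToSet (J : JointData X₁ X₂) (x₁ : X₁) (A₂ : Set X₂) : ENNReal :=
  ⨅ y ∈ A₂, ENNReal.ofReal (J.d x₁ y)

/-- `B` is an image set `𝓘(r,s;A)`: the `s`-neighbourhood of some compact `B⁻` all of whose points
have joint distance at least `s + r` to the complement of `A`. -/
def IsImageSet (J : JointData X₁ X₂) (r s : ℝ) (A : Set X₂) (B : Set X₁) : Prop :=
  ∃ Bm : Set X₁, IsCompact Bm ∧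
    Bm ⊆ {x₁ | ENNReal.ofReal (s + r) ≤ J.distToSet x₁ Aᶜ} ∧
    B = ⋃ y ∈ Bm, Metric.closedBall y s

/-- The term `2^{m(Q-q₂)} ‖σ_{2^{m+1}}(Ξ₂;f) - σ_{2^m}(Ξ₂;f)‖_A`. -/
def dyadicTerm (J : JointData X₁ X₂) (h : ℝ → ℝ) (Q q₂ : ℝ) (A : Set X₂) (f : C(X₂, ℝ))
    (m : ℕ) : ℝ :=
  (2 : ℝ) ^ ((m : ℝ) * (Q - q₂)) *
    supNormOn A (fun x => J.Ξ₂.sigma h (2 ^ (m + 1)) f x - J.Ξ₂.sigma h (2 ^ m) f x)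

end JointData

end

/-! The engine is a localization estimate for the filtered kernel, `|Φ_n(x₁,x₂)| ≤ C n^Q (1 + n
d(x₁,x₂))^(-S)`. Writing `h(u)` as a superposition of the complex Gaussians `exp(-u²(1 - 2πiξ))`
with a rapidly decreasing density makes `Φ_n` an average of the heat kernel at the complex times `(1
- 2πiξ)/n²`. The variation bound controls the heat kernel in the right half-plane. By
Phragmén–Lindelöf the Gaussian bound at real times extends to complex ones at a price polynomial in
`ξ`, which the density absorbs. This is `VariationBound.exists_localization`.

Integrated against the joint ball condition, the estimate shows that on `B` the function `σ_n(g)` is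
controlled by `n^(Q-q₂) ‖g‖_A + n^(Q-S) r^(q₂-S) ‖g‖`, because points of `B` are at joint distance
at least `r` from the complement of `A`.

For (a), put `P_m = σ_{2^m}(Ξ₂;f)` and `v_m = σ_{c2^m}(P_m)`. Polynomial preservation gives `v_m =
σ_N(P_m)` for all `N ≥ c2^m`, so `v_{m+1} - v_m` and `σ_N(f) - v_m` are images of `P_{m+1} - P_m`
and `f - P_m`. The first are summable by hypothesis, up to a geometric series. The second tend to
`0` because `P_m → f`, a consequence of the partition of unity. See
`IsJointDataSpace.exists_lift_bound`.

For (b), multiplying by a smooth local unit turns local smoothness into `‖f - P_m‖_A = O(2^(-mγ))`,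
so (a) gives the rate `2^(-mβ)` on `B`, with `β = γ - Q + q₂`. The product `φ ℰ(f)` is then
approximated by `P σ_{c2^m}(f)`, where the diffusion polynomial `P` approximates `φ`. The strong
product assumption bounds the order of this product, and the smoothness of `φ` outweighs the
polynomial growth of `σ_{c2^m}(f)`. -/

noncomputable section

/-! ### Heat series of a spectrum with a variation bound -/

/-- The counting measure of the coefficients `a` along the spectrum `l` has total variation at most
`c n ^ Q` on `[0, n)`, for every positive integer `n`. -/
def VariationBound {ι : Type*} (l a : ι → ℝ) (c Q : ℝ) : Prop :=
  ∀ n : ℕ, 0 < n → ∀ s : Finset ι, (∀ i ∈ s, l i < n) → ∑ i ∈ s, |a i| ≤ c * (n : ℝ) ^ Q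

theorem summable_succ_rpow_mul_exp_neg (Q : ℝ) :
    Summable fun j : ℕ => ((j : ℝ) + 1) ^ Q * Real.exp (-j) := by
  obtain ⟨k, hk⟩ := exists_nat_ge Q
  have h1 := (Real.summable_pow_mul_exp_neg_nat_mul k (r := 1) one_pos)
  have h2 := ((summable_nat_add_iff 1).2 h1).mul_left (Real.exp 1)
  refine Summable.of_nonneg_of_le (fun j => by positivity) (fun j => ?_) h2
  have hj : (1 : ℝ) ≤ (j : ℝ) + 1 := by linarith [Nat.cast_nonneg (α := ℝ) j]
  have h3 : ((j : ℝ) + 1) ^ Q ≤ ((j : ℝ) + 1) ^ k := by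
    rw [← Real.rpow_natCast]
    exact Real.rpow_le_rpow_of_exponent_le hj hk
  have h4 : Real.exp (-j) = Real.exp 1 * Real.exp (-1 * ((j + 1 : ℕ) : ℝ)) := by
    rw [← Real.exp_add]; congr 1; push_cast; ring
  rw [h4]
  push_cast
  calc _ ≤ ((j : ℝ) + 1) ^ k * (Real.exp 1 * Real.exp (-1 * ((j : ℝ) + 1))) := by gcongr
    _ = _ := by ring

/-- With `N ≈ 1/√t`, cut the spectrum into shells `jN ≤ l < (j+1)N`. Each has mass at most
`c((j+1)N)^Q` and weight at most `e^(-j)`, since `l²t ≥ j²N²t ≥ j² ≥ j`. The constant precedes `a`,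
because later the coefficients depend on the points where the kernel is evaluated. -/
theorem VariationBound.exists_heat_bound {ι : Type*} {l : ι → ℝ} (hl : ∀ i, 0 ≤ l i) {c Q : ℝ}
    (hc : 0 < c) (hQ : 0 < Q) :
    ∃ C : ℝ, 0 < C ∧ ∀ a : ι → ℝ, VariationBound l a c Q → ∀ t : ℝ, 0 < t → t ≤ 1 →
      Summable (fun i => |a i| * Real.exp (-(l i ^ 2 * t))) ∧
      ∑' i, |a i| * Real.exp (-(l i ^ 2 * t)) ≤ C * t ^ (-Q / 2) := by
  set T := ∑' j : ℕ, ((j : ℝ) + 1) ^ Q * Real.exp (-j) with hT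
  have hTs := summable_succ_rpow_mul_exp_neg Q
  have hTpos : 0 < T := hTs.tsum_pos (fun j => by positivity) 0 (by positivity)
  refine ⟨c * 2 ^ Q * T, by positivity, fun a ha t ht ht1 => ?_⟩
  have hst : 0 < √t := Real.sqrt_pos.2 ht
  have hst1 : √t ≤ 1 := Real.sqrt_le_one.2 ht1
  set N := ⌈1 / √t⌉₊ with hN
  have hN0 : 0 < N := Nat.ceil_pos.2 (by positivity)
  have hN1 : 1 / √t ≤ N := Nat.le_ceil _
  have hN2 : (N : ℝ) ≤ 2 / √t := by
    have h1 := (Nat.ceil_lt_add_one (a := 1 / √t) (by positivity)).le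
    have h2 : 1 ≤ 1 / √t := by rw [le_div_iff₀ hst]; linarith
    calc (N : ℝ) ≤ 1 / √t + 1 := h1
      _ ≤ 1 / √t + 1 / √t := by linarith
      _ = 2 / √t := by ring
  have hNR : (0 : ℝ) < N := by exact_mod_cast hN0
  have hNt : 1 ≤ (N : ℝ) ^ 2 * t := by
    have h1 : 1 ≤ (N : ℝ) * √t := by rwa [div_le_iff₀ hst] at hN1
    calc (1 : ℝ) ≤ ((N : ℝ) * √t) ^ 2 := by nlinarith
      _ = _ := by rw [mul_pow, Real.sq_sqrt ht.le]
  have hNQ : (N : ℝ) ^ Q ≤ 2 ^ Q * t ^ (-Q / 2) := by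
    calc (N : ℝ) ^ Q ≤ (2 / √t) ^ Q := Real.rpow_le_rpow hNR.le hN2 hQ.le
      _ = 2 ^ Q * t ^ (-Q / 2) := by
        rw [Real.div_rpow (by norm_num) hst.le, Real.sqrt_eq_rpow, ← Real.rpow_mul ht.le,
          div_eq_mul_inv, ← Real.rpow_neg ht.le]
        congr 2; ring
  have key : ∀ s : Finset ι, ∑ i ∈ s, |a i| * Real.exp (-(l i ^ 2 * t))
      ≤ c * 2 ^ Q * T * t ^ (-Q / 2) := by
    intro s
    classical
    set j : ι → ℕ := fun i => ⌊l i / N⌋₊ with hj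
    have h1 : ∀ i, Real.exp (-(l i ^ 2 * t)) ≤ Real.exp (-(j i : ℝ)) := by
      intro i
      have h2 : (j i : ℝ) * N ≤ l i := by
        have := Nat.floor_le (a := l i / N) (div_nonneg (hl i) hNR.le)
        rwa [le_div_iff₀ hNR] at this
      apply Real.exp_le_exp.2
      have h3 : (j i : ℝ) ≤ (j i : ℝ) ^ 2 := by exact_mod_cast Nat.le_self_pow two_ne_zero _
      have h4 : ((j i : ℝ) * N) ^ 2 ≤ l i ^ 2 := by gcongr
      have h5 : (j i : ℝ) ^ 2 ≤ (j i : ℝ) ^ 2 * ((N : ℝ) ^ 2 * t) :=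
        le_mul_of_one_le_right (by positivity) hNt
      have h6 : ((j i : ℝ) * N) ^ 2 * t ≤ l i ^ 2 * t := by gcongr
      nlinarith
    calc ∑ i ∈ s, |a i| * Real.exp (-(l i ^ 2 * t))
        ≤ ∑ i ∈ s, |a i| * Real.exp (-(j i : ℝ)) :=
          Finset.sum_le_sum fun i _ => mul_le_mul_of_nonneg_left (h1 i) (abs_nonneg _)
      _ = ∑ m ∈ s.image j, ∑ i ∈ s with j i = m, |a i| * Real.exp (-(j i : ℝ)) :=
          (Finset.sum_fiberwise_of_maps_to (fun i hi => Finset.mem_image_of_mem j hi) _).symm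
      _ ≤ ∑ m ∈ s.image j, c * (N : ℝ) ^ Q * (((m : ℝ) + 1) ^ Q * Real.exp (-m)) := by
          refine Finset.sum_le_sum fun m _ => ?_
          have h2 : ∑ i ∈ s with j i = m, |a i| * Real.exp (-(j i : ℝ))
              = (∑ i ∈ s with j i = m, |a i|) * Real.exp (-(m : ℝ)) := by
            rw [Finset.sum_mul]
            exact Finset.sum_congr rfl fun i hi => by rw [(Finset.mem_filter.1 hi).2]
          have h3 := ha ((m + 1) * N) (by positivity) (s.filter fun i => j i = m) (by
            intro i hi
            have h4 := Nat.lt_floor_add_one (l i / N)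
            rw [div_lt_iff₀ hNR] at h4
            have h5 : ⌊l i / N⌋₊ = m := (Finset.mem_filter.1 hi).2
            rw [h5] at h4
            push_cast; exact h4)
          rw [h2]
          push_cast at h3
          rw [Real.mul_rpow (by positivity) hNR.le] at h3
          calc _ ≤ (c * (((m : ℝ) + 1) ^ Q * (N : ℝ) ^ Q)) * Real.exp (-(m : ℝ)) := by gcongr
            _ = _ := by ring
      _ = c * (N : ℝ) ^ Q * ∑ m ∈ s.image j, (((m : ℝ) + 1) ^ Q * Real.exp (-m)) := by
          rw [Finset.mul_sum]
      _ ≤ c * (2 ^ Q * t ^ (-Q / 2)) * T := by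
          gcongr
          exact hTs.sum_le_tsum _ fun _ _ => by positivity
      _ = _ := by ring
  exact ⟨summable_of_sum_le (fun i => by positivity) key,
    Real.tsum_le_of_sum_le (fun i => by positivity) key⟩

/-- The heat series `∑ aᵢ exp (-lᵢ² z)` at complex time `z`. -/
def heatSum {ι : Type*} (l a : ι → ℝ) (z : ℂ) : ℂ :=
  ∑' i, (a i : ℂ) * Complex.exp (-((l i : ℂ) ^ 2 * z))

theorem norm_heatSum_term {ι : Type*} (l a : ι → ℝ) (z : ℂ) (i : ι) :
    ‖(a i : ℂ) * Complex.exp (-((l i : ℂ) ^ 2 * z))‖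
      = |a i| * Real.exp (-(l i ^ 2 * z.re)) := by
  rw [norm_mul, Complex.norm_real, Complex.norm_exp, Real.norm_eq_abs]
  congr 2
  rw [← Complex.ofReal_pow, Complex.neg_re, Complex.re_ofReal_mul]

theorem VariationBound.summable {ι : Type*} {l a : ι → ℝ} (hl : ∀ i, 0 ≤ l i) {c Q : ℝ}
    (hc : 0 < c) (hQ : 0 < Q) (ha : VariationBound l a c Q) {t : ℝ} (ht : 0 < t) :
    Summable (fun i => |a i| * Real.exp (-(l i ^ 2 * t))) := by
  obtain ⟨C, -, hC⟩ := VariationBound.exists_heat_bound hl hc hQ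
  refine Summable.of_nonneg_of_le (fun i => by positivity) (fun i => ?_)
    (hC a ha (min t 1) (by positivity) (min_le_right _ _)).1
  gcongr
  exact min_le_left _ _

theorem VariationBound.differentiableOn_heatSum {ι : Type*} {l a : ι → ℝ} (hl : ∀ i, 0 ≤ l i)
    {c Q : ℝ} (hc : 0 < c) (hQ : 0 < Q) (ha : VariationBound l a c Q) :
    DifferentiableOn ℂ (heatSum l a) {z | 0 < z.re} := by
  intro z hz
  have hz' : (0 : ℝ) < z.re := hz
  have ho : IsOpen {w : ℂ | z.re / 2 < w.re} := isOpen_lt continuous_const Complex.continuous_re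
  have := Complex.differentiableOn_tsum_of_summable_norm (U := {w : ℂ | z.re / 2 < w.re})
    (F := fun i w => (a i : ℂ) * Complex.exp (-((l i : ℂ) ^ 2 * w)))
    (ha.summable hl hc hQ (half_pos hz')) (fun i => by fun_prop) ho
    (fun i w hw => by
      rw [norm_heatSum_term]
      have : z.re / 2 < w.re := hw
      gcongr)
  exact (this.differentiableAt (ho.mem_nhds (show z.re / 2 < z.re by linarith))).differentiableWithinAt

theorem VariationBound.norm_heatSum_le {ι : Type*} {l : ι → ℝ} (hl : ∀ i, 0 ≤ l i) {c Q : ℝ}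
    (hc : 0 < c) (hQ : 0 < Q) :
    ∃ C : ℝ, 0 < C ∧ ∀ a : ι → ℝ, VariationBound l a c Q → ∀ z : ℂ, 0 < z.re → z.re ≤ 1 →
      ‖heatSum l a z‖ ≤ C * z.re ^ (-Q / 2) := by
  obtain ⟨C, hC0, hC⟩ := VariationBound.exists_heat_bound hl hc hQ
  refine ⟨C, hC0, fun a ha z hz hz1 => ?_⟩
  obtain ⟨h1, h2⟩ := hC a ha z.re hz hz1
  refine le_trans (norm_tsum_le_tsum_norm ?_) ?_
  · simpa only [norm_heatSum_term] using h1
  · simpa only [norm_heatSum_term] using h2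

/-! ### From real to complex times -/

/-- The Davies-type estimate: a variation bound and a Gaussian bound at real times give a bound at
complex times, by the Phragmén–Lindelöf principle in the variable `w = 1 / z`. -/
theorem VariationBound.norm_heatSum_inv_le {ι : Type*} {l : ι → ℝ} (hl : ∀ i, 0 ≤ l i) {c Q : ℝ}
    (hc : 0 < c) (hQ : 0 < Q) :
    ∃ C : ℝ, 0 < C ∧ ∀ a : ι → ℝ, VariationBound l a c Q → ∀ c₀ c₁ b : ℝ, 0 ≤ b →
      (∀ t : ℝ, 0 < t → t ≤ 1 → ‖heatSum l a t‖ ≤ c₁ * t ^ (-c₀) * Real.exp (-(b / t))) →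
      ∀ k : ℕ, Q ≤ k → c₀ ≤ k → ∀ w₀ : ℝ, 1 ≤ w₀ → ∀ w : ℂ, w₀ ≤ w.re →
        ‖heatSum l a w⁻¹‖ ≤
          C * w₀ ^ (Q / 2) * Real.exp (-(b * (w.re - w₀))) * (‖w‖ / w₀) ^ k := by
  obtain ⟨C, hC0, hC⟩ := VariationBound.norm_heatSum_le hl hc hQ
  refine ⟨C, hC0, fun a ha c₀ c₁ b hb hG k hQk hck w₀ hw₀ w hw => ?_⟩
  have hw₀' : (0 : ℝ) < w₀ := by linarith
  -- In the variable `ζ = w - w₀` the half-plane becomes `Re ζ ≥ 0`. The factor `exp(bζ)` encodes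
  -- the decay sought. The power `k` cancels the growth `(‖w‖/w₀)^Q` coming from the variation
  -- bound, and `(w₀ + x)^c₀` on the real axis.
  set f : ℂ → ℂ := fun ζ =>
    heatSum l a (w₀ + ζ)⁻¹ * Complex.exp (b * ζ) * ((w₀ : ℂ) / (w₀ + ζ)) ^ k with hf
  have hre : ∀ ζ : ℂ, 0 ≤ ζ.re → 0 < ((w₀ : ℂ) + ζ).re := fun ζ hζ => by
    rw [Complex.add_re, Complex.ofReal_re]; linarith
  have hne : ∀ ζ : ℂ, 0 ≤ ζ.re → (w₀ : ℂ) + ζ ≠ 0 := fun ζ hζ h => by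
    have := hre ζ hζ; rw [h] at this; simp at this
  have hinv : ∀ u : ℂ, u⁻¹.re = u.re / ‖u‖ ^ 2 := fun u => by
    rw [Complex.inv_re, Complex.normSq_eq_norm_sq]
  have hinvpos : ∀ ζ : ℂ, 0 ≤ ζ.re → 0 < (((w₀ : ℂ) + ζ)⁻¹).re := fun ζ hζ => by
    rw [hinv]
    have := norm_pos_iff.2 (hne ζ hζ)
    have := hre ζ hζ
    positivity
  -- the bound without exponential factor
  have hbase : ∀ ζ : ℂ, 0 ≤ ζ.re →
      ‖heatSum l a (w₀ + ζ)⁻¹‖ * ‖((w₀ : ℂ) / (w₀ + ζ)) ^ k‖ ≤ C * w₀ ^ (Q / 2) := by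
    intro ζ hζ
    set u : ℂ := w₀ + ζ with hu
    have hun : 0 < ‖u‖ := norm_pos_iff.2 (hne ζ hζ)
    have hure : w₀ ≤ u.re := by rw [hu, Complex.add_re, Complex.ofReal_re]; linarith
    have hule : u.re ≤ ‖u‖ := Complex.re_le_norm u
    have h1 : u⁻¹.re ≤ 1 := by
      rw [hinv, div_le_one (by positivity)]; nlinarith
    have h2 := hC a ha u⁻¹ (hinvpos ζ hζ) h1
    have h3 : u⁻¹.re ^ (-Q / 2) ≤ (‖u‖ ^ 2 / w₀) ^ (Q / 2) := by
      rw [neg_div, Real.rpow_neg (hinvpos ζ hζ).le, ← Real.inv_rpow (hinvpos ζ hζ).le, hinv,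
        inv_div]
      apply Real.rpow_le_rpow (by have := hre ζ hζ; positivity) _ (by positivity)
      gcongr
    have h4 : (‖u‖ ^ 2 / w₀) ^ (Q / 2) = w₀ ^ (Q / 2) * (‖u‖ / w₀) ^ Q := by
      have : ‖u‖ ^ 2 / w₀ = w₀ * (‖u‖ / w₀) ^ 2 := by field_simp
      rw [this, Real.mul_rpow hw₀'.le (by positivity), ← Real.rpow_natCast (‖u‖ / w₀) 2,
        ← Real.rpow_mul (by positivity)]
      congr 2; push_cast; ring
    have h5 : (‖u‖ / w₀) ^ Q ≤ (‖u‖ / w₀) ^ k := by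
      rw [← Real.rpow_natCast]
      exact Real.rpow_le_rpow_of_exponent_le ((one_le_div hw₀').2 (by linarith)) hQk
    have h6 : ‖((w₀ : ℂ) / u) ^ k‖ = ((‖u‖ / w₀) ^ k)⁻¹ := by
      rw [norm_pow, norm_div, Complex.norm_real, Real.norm_eq_abs, abs_of_pos hw₀', ← inv_pow,
        inv_div]
    rw [h6]
    have h7 : 0 < (‖u‖ / w₀) ^ k := by positivity
    rw [← div_eq_mul_inv, div_le_iff₀ h7]
    calc _ ≤ C * u⁻¹.re ^ (-Q / 2) := h2
      _ ≤ C * (w₀ ^ (Q / 2) * (‖u‖ / w₀) ^ k) := by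
        gcongr
        exact h3.trans (h4.le.trans (by gcongr))
      _ = _ := by ring
  have hnf : ∀ ζ : ℂ, ‖f ζ‖ = ‖heatSum l a (w₀ + ζ)⁻¹‖ * ‖((w₀ : ℂ) / (w₀ + ζ)) ^ k‖ *
      Real.exp (b * ζ.re) := fun ζ => by
    rw [hf]
    simp only
    rw [norm_mul, norm_mul, Complex.norm_exp, Complex.re_ofReal_mul]; ring
  have hdiff : DifferentiableOn ℂ f {z : ℂ | -w₀ < z.re} := by
    have hne' : ∀ z : ℂ, -w₀ < z.re → (w₀ : ℂ) + z ≠ 0 := fun z hz h => by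
      have := congrArg Complex.re h; simp at this; linarith
    have h1 : DifferentiableOn ℂ (fun ζ : ℂ => ((w₀ : ℂ) + ζ)⁻¹) {z : ℂ | -w₀ < z.re} :=
      DifferentiableOn.inv (by fun_prop) hne'
    have h2 : DifferentiableOn ℂ (fun ζ : ℂ => heatSum l a ((w₀ : ℂ) + ζ)⁻¹)
        {z : ℂ | -w₀ < z.re} := by
      refine (ha.differentiableOn_heatSum hl hc hQ).comp h1 fun z hz => ?_
      show 0 < (((w₀ : ℂ) + z)⁻¹).re
      rw [hinv]
      have h3 := norm_pos_iff.2 (hne' z hz)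
      have h4 : 0 < ((w₀ : ℂ) + z).re := by
        have : -w₀ < z.re := hz
        rw [Complex.add_re, Complex.ofReal_re]; linarith
      positivity
    have h3 : DifferentiableOn ℂ (fun ζ : ℂ => ((w₀ : ℂ) / (w₀ + ζ)) ^ k) {z : ℂ | -w₀ < z.re} :=
      ((differentiableOn_const _).div (by fun_prop) hne').pow k
    exact (h2.mul (by fun_prop)).mul h3
  have hdcc : DiffContOnCl ℂ f {z : ℂ | 0 < z.re} := by
    refine DifferentiableOn.diffContOnCl (hdiff.mono fun z hz => ?_)
    rw [Complex.closure_setOfPred_lt_re] at hz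
    have : (0 : ℝ) ≤ z.re := hz
    show -w₀ < z.re
    linarith
  -- The Gaussian bound is needed only for boundedness on the positive real axis. The final bound is
  -- the one on the imaginary axis, so `c₁` does not enter it.
  have hmain : ‖f (w - w₀)‖ ≤ C * w₀ ^ (Q / 2) := by
    refine PhragmenLindelof.right_half_plane_of_bounded_on_real hdcc ?_ ?_ ?_ ?_
    · refine ⟨1, by norm_num, b, ?_⟩
      refine Asymptotics.IsBigO.of_bound (C * w₀ ^ (Q / 2)) ?_
      refine Filter.eventually_inf_principal.2 (Eventually.of_forall fun ζ hζ => ?_)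
      have hζ' : (0 : ℝ) < ζ.re := hζ
      rw [hnf, Real.norm_eq_abs, Real.abs_exp, Real.rpow_one]
      refine mul_le_mul (hbase ζ hζ'.le) ?_ (Real.exp_pos _).le (by positivity)
      gcongr
      exact Complex.re_le_norm ζ
    · refine ⟨|c₁| * w₀ ^ c₀, ?_⟩
      rw [eventually_map]
      filter_upwards [eventually_ge_atTop 0] with x hx
      have hx' : 0 < w₀ + x := by linarith
      rw [hnf]
      have e1 : ((w₀ : ℂ) + (x : ℂ))⁻¹ = (((w₀ + x)⁻¹ : ℝ) : ℂ) := by push_cast; rfl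
      have e2 : ‖((w₀ : ℂ) / (w₀ + x)) ^ k‖ = (w₀ / (w₀ + x)) ^ k := by
        rw [norm_pow, ← Complex.ofReal_add, ← Complex.ofReal_div, Complex.norm_real,
          Real.norm_eq_abs, abs_of_pos (by positivity)]
      have e3 := hG (w₀ + x)⁻¹ (by positivity) (inv_le_one_of_one_le₀ (by linarith))
      rw [e1, e2, Complex.ofReal_re]
      have e4 : (w₀ / (w₀ + x)) ^ k ≤ (w₀ / (w₀ + x)) ^ c₀ := by
        rw [← Real.rpow_natCast]
        exact Real.rpow_le_rpow_of_exponent_ge (by positivity)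
          ((div_le_one hx').2 (by linarith)) hck
      have e5 : ((w₀ + x)⁻¹) ^ (-c₀) = (w₀ + x) ^ c₀ := by
        rw [Real.rpow_neg (by positivity), Real.inv_rpow hx'.le, inv_inv]
      have e6 : (w₀ + x) ^ c₀ * (w₀ / (w₀ + x)) ^ c₀ = w₀ ^ c₀ := by
        rw [← Real.mul_rpow hx'.le (by positivity), mul_div_cancel₀ _ hx'.ne']
      rw [e5, div_inv_eq_mul] at e3
      calc _ ≤ (|c₁| * (w₀ + x) ^ c₀ * Real.exp (-(b * (w₀ + x)))) * (w₀ / (w₀ + x)) ^ c₀ *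
            Real.exp (b * x) := by
            gcongr
            refine e3.trans ?_
            gcongr
            exact le_abs_self _
        _ = |c₁| * ((w₀ + x) ^ c₀ * (w₀ / (w₀ + x)) ^ c₀) *
            (Real.exp (-(b * (w₀ + x))) * Real.exp (b * x)) := by ring
        _ ≤ |c₁| * ((w₀ + x) ^ c₀ * (w₀ / (w₀ + x)) ^ c₀) * 1 := by
            gcongr
            rw [← Real.exp_add]
            apply Real.exp_le_one_iff.2
            nlinarith [mul_nonneg hb hw₀'.le]
        _ = _ := by rw [e6, mul_one]
    · intro x
      rw [hnf]
      have : (x * Complex.I : ℂ).re = 0 := by simp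
      rw [this, mul_zero, Real.exp_zero, mul_one]
      exact hbase _ this.ge
    · simp; linarith
  rw [hnf] at hmain
  have hwpos : 0 < ‖w‖ := lt_of_lt_of_le (by linarith) (Complex.re_le_norm w)
  have h6 : ‖((w₀ : ℂ) / w) ^ k‖ = ((‖w‖ / w₀) ^ k)⁻¹ := by
    rw [norm_pow, norm_div, Complex.norm_real, Real.norm_eq_abs, abs_of_pos hw₀', ← inv_pow,
      inv_div]
  rw [add_sub_cancel, h6, Complex.sub_re, Complex.ofReal_re] at hmain
  rw [Real.exp_neg]
  have h7 : 0 < (‖w‖ / w₀) ^ k := by positivity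
  have h8 := Real.exp_pos (b * (w.re - w₀))
  have h9 : ‖heatSum l a w⁻¹‖ = ‖heatSum l a w⁻¹‖ * ((‖w‖ / w₀) ^ k)⁻¹ *
      Real.exp (b * (w.re - w₀)) * (Real.exp (b * (w.re - w₀)))⁻¹ * (‖w‖ / w₀) ^ k := by
    field_simp
  rw [h9]
  gcongr

/-! ### Filters as superpositions of Gaussians, and localization -/

theorem IsLowPassFilter.abs_eq {h : ℝ → ℝ} (hh : IsLowPassFilter h) (t : ℝ) : h |t| = h t := by
  rcases abs_choice t with h1 | h1 <;> rw [h1]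
  exact hh.even t

/-- The singularity of `√|v|` at `0` is invisible because `h = 1` on `[0, 1/2]`. -/
theorem IsLowPassFilter.contDiff_comp_sqrt {h : ℝ → ℝ} (hh : IsLowPassFilter h) :
    ContDiff ℝ ((⊤ : ℕ∞) : WithTop ℕ∞) (fun v : ℝ => h √|v|) := by
  rw [contDiff_iff_contDiffAt]
  intro v
  by_cases hv : v = 0
  · subst hv
    have : (fun v : ℝ => h √|v|) =ᶠ[𝓝 0] fun _ => 1 := by
      filter_upwards [Metric.ball_mem_nhds (0 : ℝ) (show (0 : ℝ) < 1 / 4 by norm_num)] with x hx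
      rw [Metric.mem_ball, dist_zero_right, Real.norm_eq_abs] at hx
      refine hh.eq_one _ (Real.sqrt_nonneg _) ?_
      rw [Real.sqrt_le_left (by norm_num)]
      linarith
    exact contDiffAt_const.congr_of_eventuallyEq this
  · exact hh.smooth.contDiffAt.comp v
      ((Real.contDiffAt_sqrt (abs_ne_zero.2 hv)).comp v (contDiffAt_abs hv))

open SchwartzMap FourierTransform in
/-- A low pass filter is a superposition of complex Gaussians with rapidly decreasing density. -/
theorem IsLowPassFilter.exists_gaussian_superposition {h : ℝ → ℝ} (hh : IsLowPassFilter h) :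
    ∃ p : ℝ → ℂ, Continuous p ∧ (∀ k : ℕ, Integrable fun ξ => |ξ| ^ k * ‖p ξ‖) ∧
      ∀ u : ℝ, (h u : ℂ) =
        ∫ ξ : ℝ, p ξ * Complex.exp (-((u : ℂ) ^ 2 * (1 - 2 * Real.pi * ξ * Complex.I))) := by
  -- The factor `exp v` is divided out again after Fourier inversion at `v = u²`. It puts the real
  -- part `1` into the exponents, so that the times obtained lie in the open right half-plane.
  set g : ℝ → ℂ := fun v => ((h √|v| * Real.exp v : ℝ) : ℂ) with hg
  have hsm : ContDiff ℝ ((⊤ : ℕ∞) : WithTop ℕ∞) g :=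
    Complex.ofRealCLM.contDiff.comp (hh.contDiff_comp_sqrt.mul Real.contDiff_exp)
  have hcs : HasCompactSupport g := by
    refine HasCompactSupport.of_support_subset_isCompact (isCompact_closedBall (0 : ℝ) 1)
      fun v hv => ?_
    by_contra hv'
    apply hv
    rw [Metric.mem_closedBall, dist_zero_right, Real.norm_eq_abs, not_le] at hv'
    have : h √|v| = 0 := hh.eq_zero _ (Real.one_le_sqrt.2 hv'.le)
    simp [hg, this]
  set G : 𝓢(ℝ, ℂ) := hcs.toSchwartzMap hsm with hG
  set Gh : 𝓢(ℝ, ℂ) := 𝓕 G with hGh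
  refine ⟨Gh, Gh.continuous, fun k => by simpa using Gh.integrable_pow_mul volume k,
    fun u => ?_⟩
  have h1 : (𝓕⁻ Gh) (u ^ 2) = G (u ^ 2) := by rw [hGh, FourierTransform.fourierInv_fourier_eq]
  have h2 : G (u ^ 2) = (h u : ℂ) * Complex.exp ((u : ℂ) ^ 2) := by
    change g (u ^ 2) = _
    simp only [hg]
    rw [abs_of_nonneg (sq_nonneg u), Real.sqrt_sq_eq_abs, hh.abs_eq]
    push_cast; rfl
  rw [h2, fourierInv_coe, Real.fourierInv_eq'] at h1
  have h3 : (h u : ℂ) = Complex.exp (-((u : ℂ) ^ 2)) * ((h u : ℂ) * Complex.exp ((u : ℂ) ^ 2)) := by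
    rw [mul_left_comm, ← Complex.exp_add]; simp
  rw [h3, ← h1, ← integral_const_mul]
  refine integral_congr_ae (Eventually.of_forall fun ξ => ?_)
  simp only [smul_eq_mul]
  rw [← mul_assoc, ← Complex.exp_add, mul_comm]
  congr 2
  simp
  ring

/-- Fubini applies because the modulus of each heat term depends only on the real part `1/n²` of the
time, which is the same for all `ξ`. -/
theorem VariationBound.tsum_filter_eq_integral {ι : Type*} [Countable ι] {l a : ι → ℝ}
    (hl : ∀ i, 0 ≤ l i) {c Q : ℝ} (hc : 0 < c) (hQ : 0 < Q) (ha : VariationBound l a c Q)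
    {h : ℝ → ℝ} {p : ℝ → ℂ} (hp : Continuous p) (hpi : Integrable p)
    (hph : ∀ u : ℝ, (h u : ℂ) =
        ∫ ξ : ℝ, p ξ * Complex.exp (-((u : ℂ) ^ 2 * (1 - 2 * Real.pi * ξ * Complex.I))))
    {n : ℝ} (hn : 0 < n) :
    ((∑' i, h (l i / n) * a i : ℝ) : ℂ) =
      ∫ ξ : ℝ, p ξ * heatSum l a ((1 - (2 * Real.pi * ξ : ℝ) * Complex.I) / n ^ 2) := by
  set F : ι → ℝ → ℂ := fun i ξ => p ξ * ((a i : ℂ) * Complex.exp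
    (-((l i : ℂ) ^ 2 * ((1 - (2 * Real.pi * ξ : ℝ) * Complex.I) / n ^ 2)))) with hF
  have hre : ∀ ξ : ℝ, ((1 - (2 * Real.pi * ξ : ℝ) * Complex.I) / (n : ℂ) ^ 2).re = 1 / n ^ 2 := by
    intro ξ
    rw [← Complex.ofReal_pow, Complex.div_ofReal_re]
    simp
  have hnorm : ∀ i ξ, ‖F i ξ‖ = ‖p ξ‖ * (|a i| * Real.exp (-(l i ^ 2 * (1 / n ^ 2)))) := by
    intro i ξ
    rw [hF]; simp only
    rw [norm_mul, norm_heatSum_term, hre]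
  have hint : ∀ i, Integrable (F i) := fun i => by
    refine (hpi.norm.mul_const (|a i| * Real.exp (-(l i ^ 2 * (1 / n ^ 2))))).mono' ?_
      (Eventually.of_forall fun ξ => (hnorm i ξ).le)
    exact (by simp only [hF]; fun_prop : Continuous (F i)).aestronglyMeasurable
  have hsum : Summable fun i => ∫ ξ, ‖F i ξ‖ := by
    simp only [hnorm, integral_mul_const]
    exact (ha.summable hl hc hQ (by positivity)).mul_left _
  have h1 := hasSum_integral_of_summable_integral_norm hint hsum
  have h2 : ∀ i, ∫ ξ, F i ξ = ((h (l i / n) * a i : ℝ) : ℂ) := fun i => by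
    push_cast
    rw [hph, ← integral_mul_const]
    congr 1
    ext ξ
    simp only [hF]
    rw [mul_comm (a i : ℂ), ← mul_assoc]
    congr 3
    push_cast
    ring
  simp only [h2] at h1
  rw [Complex.ofReal_tsum, h1.tsum_eq]
  congr 1
  ext ξ
  simp only [hF, heatSum, tsum_mul_left]

/-- For `y = cX²/(2E)` one has `1 + X ≤ 2(1 + 2/c) E (1 + y)`, and `(1 + y)^S ≤ S! e^(1+y)`.
Gaussian decay at the reduced rate `c/(2E)` thus still beats any power of `X`, at the price `E^S`.
-/
theorem one_add_pow_mul_exp_neg_le {c : ℝ} (hc : 0 < c) (S : ℕ) {X E : ℝ} (hX : 0 ≤ X)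
    (hE : 1 ≤ E) :
    (1 + X) ^ S * Real.exp (-(c * X ^ 2 / (2 * E))) ≤
      (2 * (1 + 2 / c)) ^ S * (S.factorial * Real.exp 1) * E ^ S := by
  set y := c * X ^ 2 / (2 * E) with hy
  have hE0 : 0 < E := by linarith
  have hy0 : 0 ≤ y := by positivity
  have h1 : 1 + X ≤ 2 * (1 + X ^ 2) := by nlinarith
  have h2 : X ^ 2 = 2 / c * E * y := by rw [hy]; field_simp
  have hc2 : 0 < 2 / c := by positivity
  have h3 : 1 + X ^ 2 ≤ E * ((1 + 2 / c) * (1 + y)) := by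
    rw [h2]
    have e1 : 0 ≤ E * y := by positivity
    have e2 : 0 ≤ E * (2 / c) := by positivity
    nlinarith
  have h4 := Real.pow_div_factorial_le_exp (1 + y) (by positivity) S
  rw [div_le_iff₀ (by positivity), Real.exp_add] at h4
  rw [Real.exp_neg, ← div_eq_mul_inv, div_le_iff₀ (Real.exp_pos _)]
  calc (1 + X) ^ S ≤ (2 * (E * ((1 + 2 / c) * (1 + y)))) ^ S := by
        gcongr; exact h1.trans (by linarith)
    _ = (2 * (1 + 2 / c)) ^ S * E ^ S * (1 + y) ^ S := by
        rw [← mul_pow, ← mul_pow]; ring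
    _ ≤ (2 * (1 + 2 / c)) ^ S * E ^ S * (Real.exp 1 * Real.exp y * S.factorial) := by gcongr
    _ = _ := by ring

/-- Decay of the heat series at the complex times `(1 - iη) / n²`. -/
theorem VariationBound.exists_complex_time_bound {ι : Type*} {l : ι → ℝ}
    (hl : ∀ i, 0 ≤ l i) {c Q c₀ c₁ c₂ D : ℝ} (hc : 0 < c) (hQ : 0 < Q) (hc₂ : 0 < c₂) (hD : 0 ≤ D)
    (S : ℕ) :
    ∃ (C : ℝ) (k : ℕ), 0 < C ∧ ∀ a : ι → ℝ, VariationBound l a c Q → ∀ r : ℝ, 0 ≤ r → r ≤ D →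
      (∀ t : ℝ, 0 < t → t ≤ 1 →
        ‖heatSum l a t‖ ≤ c₁ * t ^ (-c₀) * Real.exp (-(c₂ * (r ^ 2 / t)))) →
      ∀ n : ℝ, 1 ≤ n → ∀ η : ℝ,
        ‖heatSum l a ((1 - η * Complex.I) / n ^ 2)‖ * (1 + n * r) ^ S ≤
          C * n ^ Q * (1 + η ^ 2) ^ k := by
  obtain ⟨C₁, hC₁, H₁⟩ := VariationBound.norm_heatSum_le hl hc hQ
  obtain ⟨C₂, hC₂, H₂⟩ := VariationBound.norm_heatSum_inv_le hl hc hQ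
  obtain ⟨k, hk⟩ := exists_nat_ge (max Q c₀)
  have hkQ : Q ≤ k := (le_max_left _ _).trans hk
  have hkc : c₀ ≤ k := (le_max_right _ _).trans hk
  set M := (2 * (1 + 2 / c₂)) ^ S * (S.factorial * Real.exp 1) with hM
  have hM0 : 0 < M := by positivity
  refine ⟨C₁ * (1 + 2 * D) ^ S + C₂ * M * 2 ^ k, S + k, by positivity,
    fun a ha r hr hrD hG n hn η => ?_⟩
  have hn0 : 0 < n := by linarith
  set E := 1 + η ^ 2 with hE
  have hE1 : 1 ≤ E := by rw [hE]; nlinarith [sq_nonneg η]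
  have hE0 : 0 < E := by linarith
  have hnQ : (n ^ 2) ^ (Q / 2) = n ^ Q := by
    rw [← Real.rpow_natCast, ← Real.rpow_mul hn0.le]; congr 1; push_cast; ring
  have hzre : ((1 - η * Complex.I) / (n : ℂ) ^ 2).re = 1 / n ^ 2 := by
    rw [← Complex.ofReal_pow, Complex.div_ofReal_re]; simp
  -- The inverse time `w` has real part `n²/E`, and the Davies estimate needs a base point `w₀ ≥ 1`
  -- below it. In the other case `n ≤ 2E`, so `1 + nr ≤ (1 + 2D)E` and the bound without decay
  -- suffices.
  by_cases hR : 2 ≤ n ^ 2 / E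
  · set w : ℂ := ((n ^ 2 / E : ℝ) : ℂ) * (1 + η * Complex.I) with hw
    have hwre : w.re = n ^ 2 / E := by rw [hw, Complex.re_ofReal_mul]; simp
    have hwinv : (1 - η * Complex.I) / (n : ℂ) ^ 2 = w⁻¹ := by
      symm
      rw [inv_eq_iff_eq_inv, inv_div, hw, eq_div_iff]
      · have hI : (1 + η * Complex.I) * (1 - η * Complex.I) = ((E : ℝ) : ℂ) := by
          rw [hE]; push_cast; ring_nf; rw [Complex.I_sq]; ring
        have hE' : ((E : ℝ) : ℂ) ≠ 0 := by exact_mod_cast hE0.ne'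
        rw [mul_assoc, hI]
        push_cast
        field_simp
      · intro h0
        have := congrArg Complex.re h0
        simp at this
    have hwn : ‖w‖ / (n ^ 2 / E / 2) ≤ 2 * E := by
      have e0 : ‖(1 + η * Complex.I : ℂ)‖ ^ 2 = E := by
        rw [Complex.sq_norm, Complex.normSq_apply, hE]; simp; ring
      have e1 : ‖(1 + η * Complex.I : ℂ)‖ ≤ E :=
        abs_le_of_sq_le_sq (by rw [e0]; nlinarith) hE0.le |> le_trans (le_abs_self _)
      have e2 : ‖w‖ = n ^ 2 / E * ‖(1 + η * Complex.I : ℂ)‖ := by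
        rw [hw, norm_mul, Complex.norm_real, Real.norm_eq_abs, abs_of_pos (by positivity)]
      have e3 : ‖w‖ / (n ^ 2 / E / 2) = 2 * ‖(1 + η * Complex.I : ℂ)‖ := by
        rw [e2]; field_simp
      rw [e3]; linarith
    -- Half of `Re w` as base point keeps half of the Gaussian exponent and makes `‖w‖/w₀ ≤ 2E`.
    have hb := H₂ a ha c₀ c₁ (c₂ * r ^ 2) (by positivity)
      (fun t ht ht1 => by rw [mul_div_assoc]; exact hG t ht ht1) k hkQ hkc (n ^ 2 / E / 2)
      (by linarith) w (by rw [hwre]; linarith)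
    rw [hwre, ← hwinv] at hb
    have e4 : c₂ * r ^ 2 * (n ^ 2 / E - n ^ 2 / E / 2) = c₂ * (n * r) ^ 2 / (2 * E) := by
      field_simp; ring
    have e5 : (n ^ 2 / E / 2) ^ (Q / 2) ≤ n ^ Q := by
      rw [← hnQ]
      refine Real.rpow_le_rpow (by positivity) ?_ (by positivity)
      rw [div_div]
      exact div_le_self (by positivity) (by linarith)
    have e6 := one_add_pow_mul_exp_neg_le hc₂ S (mul_nonneg hn0.le hr) hE1
    rw [e4] at hb
    have e7 : (0 : ℝ) ≤ 1 + n * r := by positivity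
    calc _ ≤ (C₂ * n ^ Q * Real.exp (-(c₂ * (n * r) ^ 2 / (2 * E))) * (2 * E) ^ k) *
          (1 + n * r) ^ S := by
          gcongr
          exact hb.trans (by gcongr)
      _ = C₂ * n ^ Q * (2 * E) ^ k *
          ((1 + n * r) ^ S * Real.exp (-(c₂ * (n * r) ^ 2 / (2 * E)))) := by ring
      _ ≤ C₂ * n ^ Q * (2 * E) ^ k * (M * E ^ S) := by gcongr
      _ = (0 + C₂ * M * 2 ^ k) * n ^ Q * E ^ (S + k) := by rw [mul_pow, pow_add]; ring
      _ ≤ _ := by gcongr; positivity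
  · push Not at hR
    rw [div_lt_iff₀ hE0] at hR
    have hz1 : 1 / n ^ 2 ≤ 1 := by
      rw [div_le_one (by positivity)]; nlinarith
    have hb := H₁ a ha ((1 - η * Complex.I) / (n : ℂ) ^ 2) (by rw [hzre]; positivity)
      (by rw [hzre]; exact hz1)
    have e1 : (1 / n ^ 2 : ℝ) ^ (-Q / 2) = n ^ Q := by
      rw [one_div, Real.inv_rpow (by positivity), neg_div, Real.rpow_neg (by positivity), inv_inv,
        hnQ]
    rw [hzre, e1] at hb
    have e2 : n ≤ 2 * E := by nlinarith
    have e3 : 1 + n * r ≤ (1 + 2 * D) * E := by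
      have : n * r ≤ 2 * E * D := by gcongr
      nlinarith
    calc _ ≤ (C₁ * n ^ Q) * ((1 + 2 * D) * E) ^ S := by gcongr
      _ = (C₁ * (1 + 2 * D) ^ S + 0) * n ^ Q * (E ^ S * 1) := by rw [mul_pow]; ring
      _ ≤ _ := by
        rw [pow_add]
        gcongr
        · positivity
        · exact one_le_pow₀ hE1

/-- Localization of filtered sums: the smooth cut off at level `n` of a spectral sum with a
variation bound and a Gaussian bound at distance `r` decays like `n ^ Q (1 + n r) ^ (-S)`. -/
theorem VariationBound.exists_localization {ι : Type*} [Countable ι] {l : ι → ℝ}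
    (hl : ∀ i, 0 ≤ l i) {h : ℝ → ℝ} (hh : IsLowPassFilter h)
    {c Q c₀ c₁ c₂ D : ℝ} (hc : 0 < c) (hQ : 0 < Q) (hc₂ : 0 < c₂) (hD : 0 ≤ D) (S : ℕ) :
    ∃ C : ℝ, 0 < C ∧ ∀ a : ι → ℝ, VariationBound l a c Q → ∀ r : ℝ, 0 ≤ r → r ≤ D →
      (∀ t : ℝ, 0 < t → t ≤ 1 →
        ‖heatSum l a t‖ ≤ c₁ * t ^ (-c₀) * Real.exp (-(c₂ * (r ^ 2 / t)))) →
      ∀ n : ℝ, 1 ≤ n → |∑' i, h (l i / n) * a i| * (1 + n * r) ^ S ≤ C * n ^ Q := by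
  obtain ⟨C, k, hC, H⟩ := VariationBound.exists_complex_time_bound (c₀ := c₀) (c₁ := c₁)
    hl hc hQ hc₂ hD S
  obtain ⟨p, hpc, hpi, hph⟩ := hh.exists_gaussian_superposition
  have hpi0 : Integrable p := by
    have := hpi 0
    simp only [pow_zero, one_mul] at this
    exact (integrable_norm_iff hpc.aestronglyMeasurable).1 this
  have hw : Integrable fun ξ : ℝ => ‖p ξ‖ * (1 + (2 * Real.pi * ξ) ^ 2) ^ k := by
    have : (fun ξ : ℝ => ‖p ξ‖ * (1 + (2 * Real.pi * ξ) ^ 2) ^ k) = fun ξ =>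
        ∑ j ∈ Finset.range (k + 1), ((2 * Real.pi) ^ 2) ^ j * (k.choose j) *
          (|ξ| ^ (2 * j) * ‖p ξ‖) := by
      ext ξ
      rw [add_comm, add_pow, Finset.mul_sum]
      refine Finset.sum_congr rfl fun j _ => ?_
      rw [pow_mul |ξ|, sq_abs, mul_pow (2 * Real.pi) ξ 2, mul_pow, one_pow]; ring
    rw [this]
    exact integrable_finsetSum _ fun j _ => (hpi (2 * j)).const_mul _
  set I := ∫ ξ : ℝ, ‖p ξ‖ * (1 + (2 * Real.pi * ξ) ^ 2) ^ k with hI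
  have hI0 : 0 ≤ I := integral_nonneg fun ξ => by positivity
  refine ⟨C * (I + 1), by positivity, fun a ha r hr hrD hG n hn => ?_⟩
  have hn0 : 0 < n := by linarith
  have hX : 0 < (1 + n * r) ^ S := by positivity
  have h1 := ha.tsum_filter_eq_integral hl hc hQ hpc hpi0 hph hn0
  have h2 : |∑' i, h (l i / n) * a i| ≤ C * n ^ Q / (1 + n * r) ^ S * I := by
    rw [← Real.norm_eq_abs, ← Complex.norm_real, h1, hI, ← integral_const_mul]
    refine norm_integral_le_of_norm_le (hw.const_mul _) (Eventually.of_forall fun ξ => ?_)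
    have h3 := H a ha r hr hrD hG n hn (2 * Real.pi * ξ)
    rw [← le_div_iff₀ hX] at h3
    rw [norm_mul]
    calc _ ≤ ‖p ξ‖ * (C * n ^ Q * (1 + (2 * Real.pi * ξ) ^ 2) ^ k / (1 + n * r) ^ S) := by gcongr
      _ = _ := by ring
  calc _ ≤ C * n ^ Q / (1 + n * r) ^ S * I * (1 + n * r) ^ S := by gcongr
    _ = C * n ^ Q * I := by field_simp
    _ ≤ C * n ^ Q * (I + 1) := by gcongr; linarith
    _ = _ := by ring

/-! ### Integration against localized kernels -/

/-- On the annulus `2^k r ≤ d < 2^(k+1) r` the integrand is at most `(2^k r)^(-S)` and the measure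
at most `c(2^(k+1) r)^q`, which gives a geometric series of ratio `2^(q-S) < 1`. A general function
`d` covers both the metric and the joint distance. -/
theorem exists_integral_tail_bound {X : Type*} [MeasurableSpace X] (μ : Measure X)
    [IsProbabilityMeasure μ] {c q : ℝ} (hc : 0 < c) {S : ℕ} (hqS : q < S) :
    ∃ C : ℝ, 0 < C ∧ ∀ d : X → ℝ, Measurable d → (∀ x, 0 ≤ d x) →
      (∀ ρ : ℝ, 0 < ρ → μ.real {x | d x ≤ ρ} ≤ c * ρ ^ q) → ∀ r : ℝ, 0 < r →
      Integrable ({x | r ≤ d x}.indicator fun x => (d x ^ S)⁻¹) μ ∧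
      ∫ x, {x | r ≤ d x}.indicator (fun x => (d x ^ S)⁻¹) x ∂μ ≤ C * r ^ (q - S) := by
  set ρ : ℝ := 2 ^ (q - S) with hρ
  have hρ0 : 0 < ρ := by positivity
  have hρ1 : ρ < 1 := Real.rpow_lt_one_of_one_lt_of_neg (by norm_num) (by linarith)
  have h1ρ : 0 < 1 - ρ := by linarith
  refine ⟨c * 2 ^ q * (1 - ρ)⁻¹, by positivity, fun d hd hd0 hball r hr => ?_⟩
  set f : X → ℝ := {x | r ≤ d x}.indicator fun x => (d x ^ S)⁻¹ with hf
  have hmeas : MeasurableSet {x | r ≤ d x} := measurableSet_le measurable_const hd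
  have hfm : Measurable f := ((hd.pow_const S).inv).indicator hmeas
  have hf0 : ∀ x, 0 ≤ f x := fun x => indicator_nonneg (fun y _ => by
    have := hd0 y; positivity) x
  have hint : Integrable f μ := by
    refine Integrable.of_bound hfm.aestronglyMeasurable (r ^ S)⁻¹ (Eventually.of_forall fun x => ?_)
    rw [Real.norm_eq_abs, abs_of_nonneg (hf0 x)]
    by_cases hx : r ≤ d x
    · rw [hf, indicator_of_mem (show x ∈ {x | r ≤ d x} from hx)]
      gcongr
    · rw [hf, indicator_of_notMem (show x ∉ {x | r ≤ d x} from hx)]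
      positivity
  refine ⟨hint, ?_⟩
  set E : ℕ → Set X := fun k => {x | d x ≤ 2 ^ (k + 1) * r} with hE
  have hEm : ∀ k, MeasurableSet (E k) := fun k => measurableSet_le hd measurable_const
  have hpt : ∀ x, ENNReal.ofReal (f x) ≤
      ∑' k : ℕ, (E k).indicator (fun _ => ENNReal.ofReal (((2 ^ k * r) ^ S)⁻¹)) x := by
    intro x
    by_cases hx : r ≤ d x
    · have hxr : 1 ≤ d x / r := by rwa [one_le_div hr]
      obtain ⟨k, hk1, hk2⟩ := exists_nat_pow_near hxr (one_lt_two (α := ℝ))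
      rw [le_div_iff₀ hr] at hk1
      rw [div_lt_iff₀ hr] at hk2
      refine le_trans ?_ (ENNReal.le_tsum k)
      have hxE : x ∈ E k := hk2.le
      rw [indicator_of_mem hxE, hf, indicator_of_mem (show x ∈ {x | r ≤ d x} from hx)]
      apply ENNReal.ofReal_le_ofReal
      gcongr
    · rw [hf, indicator_of_notMem (show x ∉ {x | r ≤ d x} from hx)]
      simp
  have hgeo : HasSum (fun k : ℕ => c * 2 ^ q * r ^ (q - S) * ρ ^ k)
      (c * 2 ^ q * r ^ (q - S) * (1 - ρ)⁻¹) := (hasSum_geometric_of_lt_one hρ0.le hρ1).mul_left _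
  rw [integral_eq_lintegral_of_nonneg_ae (Eventually.of_forall hf0) hfm.aestronglyMeasurable]
  refine ENNReal.toReal_le_of_le_ofReal (by positivity) ?_
  calc ∫⁻ x, ENNReal.ofReal (f x) ∂μ
      ≤ ∫⁻ x, ∑' k : ℕ, (E k).indicator (fun _ => ENNReal.ofReal (((2 ^ k * r) ^ S)⁻¹)) x ∂μ :=
        lintegral_mono hpt
    _ = ∑' k : ℕ, ENNReal.ofReal (((2 ^ k * r) ^ S)⁻¹) * μ (E k) := by
        rw [lintegral_tsum fun k => (measurable_const.indicator (hEm k)).aemeasurable]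
        congr 1; ext k
        rw [lintegral_indicator_const (hEm k)]
    _ ≤ ∑' k : ℕ, ENNReal.ofReal (c * 2 ^ q * r ^ (q - S) * ρ ^ k) := by
        refine ENNReal.tsum_le_tsum fun k => ?_
        have h1 := hball (2 ^ (k + 1) * r) (by positivity)
        have h2 : μ (E k) = ENNReal.ofReal (μ.real (E k)) := by
          rw [ofReal_measureReal]
        rw [h2, ← ENNReal.ofReal_mul (by positivity)]
        apply ENNReal.ofReal_le_ofReal
        calc _ ≤ ((2 ^ k * r) ^ S)⁻¹ * (c * (2 ^ (k + 1) * r) ^ q) := by gcongr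
          _ = _ := by
            rw [hρ, Real.rpow_sub hr, Real.rpow_sub two_pos, Real.mul_rpow (by positivity) hr.le,
              ← Real.rpow_natCast 2 (k + 1), ← Real.rpow_mul two_pos.le, div_pow,
              ← Real.rpow_natCast (2 ^ q) k, ← Real.rpow_mul two_pos.le, Real.rpow_natCast,
              Real.rpow_natCast, mul_pow]
            push_cast
            rw [add_mul, Real.rpow_add two_pos, one_mul, ← pow_mul, ← pow_mul, mul_comm S k,
              mul_comm q]
            field_simp
    _ = ENNReal.ofReal (c * 2 ^ q * r ^ (q - S) * (1 - ρ)⁻¹) := by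
        rw [← ENNReal.ofReal_tsum_of_nonneg (fun k => by positivity) hgeo.summable, hgeo.tsum_eq]
    _ = _ := by congr 1; ring

/-- Integration against a localized kernel `K`, separating the contributions near to and far from
the centre. -/
theorem exists_integral_kernel_bound {X : Type*} [MeasurableSpace X] (μ : Measure X)
    [IsProbabilityMeasure μ] {c q : ℝ} (hc : 0 < c) {S : ℕ} (hqS : q < S) :
    ∃ C : ℝ, 0 < C ∧ ∀ d : X → ℝ, Measurable d → (∀ x, 0 ≤ d x) →
      (∀ ρ : ℝ, 0 < ρ → μ.real {x | d x ≤ ρ} ≤ c * ρ ^ q) →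
      ∀ n r M G₁ G₂ : ℝ, 0 < n → 0 < r → 0 ≤ M → 0 ≤ G₁ → 0 ≤ G₂ → ∀ K g : X → ℝ,
      (∀ x, |K x| * (1 + n * d x) ^ S ≤ M) → (∀ x, d x < r → |g x| ≤ G₁) → (∀ x, |g x| ≤ G₂) →
      |∫ x, K x * g x ∂μ| ≤
        C * M * (n ^ (-q) * G₁ + n ^ (-(S : ℝ)) * r ^ (q - S) * G₂) := by
  obtain ⟨C, hC, H⟩ := exists_integral_tail_bound μ hc hqS
  refine ⟨c + C, by positivity, fun d hd hd0 hball n r M G₁ G₂ hn hr hM hG₁ hG₂ K g hK h1 h2 => ?_⟩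
  obtain ⟨hi1, hb1⟩ := H d hd hd0 hball n⁻¹ (by positivity)
  obtain ⟨hi2, hb2⟩ := H d hd hd0 hball r hr
  have hmeas : MeasurableSet {x | d x ≤ n⁻¹} := measurableSet_le hd measurable_const
  have hi0 : Integrable ({x | d x ≤ n⁻¹}.indicator fun _ => (1 : ℝ)) μ :=
    (integrable_const 1).indicator hmeas
  have hb0 : ∫ x, {x | d x ≤ n⁻¹}.indicator (fun _ => (1 : ℝ)) x ∂μ ≤ c * n⁻¹ ^ q := by
    rw [integral_indicator_const _ hmeas, smul_eq_mul, mul_one]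
    exact hball _ (by positivity)
  have hnS : (0 : ℝ) < n ^ S := by positivity
  -- Three pieces: `|K| ≤ M` where `d ≤ 1/n`, `|K| ≤ M(nd)^(-S)` where `d ≥ 1/n`, both weighted by
  -- `G₁`, and the latter decay where `d ≥ r`, weighted by `G₂`.
  set F : X → ℝ := fun x => M * (G₁ * ({x | d x ≤ n⁻¹}.indicator (fun _ => (1 : ℝ)) x +
    (n ^ S)⁻¹ * {x | n⁻¹ ≤ d x}.indicator (fun x => (d x ^ S)⁻¹) x) +
    G₂ * ((n ^ S)⁻¹ * {x | r ≤ d x}.indicator (fun x => (d x ^ S)⁻¹) x)) with hF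
  have hFi : Integrable F μ :=
    (((hi0.add (hi1.const_mul _)).const_mul _).add ((hi2.const_mul _).const_mul _)).const_mul _
  have hpt : ∀ x, ‖K x * g x‖ ≤ F x := by
    intro x
    have hdx := hd0 x
    have hpos : 0 < (1 + n * d x) ^ S := by positivity
    have hKx : |K x| ≤ M * ((1 + n * d x) ^ S)⁻¹ := by
      rw [← div_eq_mul_inv, le_div_iff₀ hpos]; exact hK x
    have hKM : |K x| ≤ M := hKx.trans (mul_le_of_le_one_right hM
      (inv_le_one_of_one_le₀ (one_le_pow₀ (by nlinarith [mul_nonneg hn.le hdx]))))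
    have hKd : 0 < d x → |K x| ≤ M * ((n ^ S)⁻¹ * (d x ^ S)⁻¹) := fun hdp => by
      refine hKx.trans ?_
      rw [← mul_inv, ← mul_pow]
      gcongr
      linarith
    have hind0 : ∀ r', 0 ≤ {x | r' ≤ d x}.indicator (fun x => (d x ^ S)⁻¹) x := fun r' =>
      indicator_nonneg (fun y _ => by have := hd0 y; positivity) x
    have hone0 : 0 ≤ {x | d x ≤ n⁻¹}.indicator (fun _ => (1 : ℝ)) x :=
      indicator_nonneg (fun _ _ => zero_le_one) x
    have hi_r := hind0 r
    have hi_n := hind0 n⁻¹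
    rw [norm_mul, Real.norm_eq_abs, Real.norm_eq_abs]
    by_cases hxr : d x < r
    · have hg := h1 x hxr
      have key : |K x| ≤ M * ({x | d x ≤ n⁻¹}.indicator (fun _ => (1 : ℝ)) x +
          (n ^ S)⁻¹ * {x | n⁻¹ ≤ d x}.indicator (fun x => (d x ^ S)⁻¹) x) := by
        by_cases hxn : d x ≤ n⁻¹
        · rw [indicator_of_mem (show x ∈ {x | d x ≤ n⁻¹} from hxn)]
          refine hKM.trans (le_mul_of_one_le_right hM ?_)
          have : 0 ≤ (n ^ S)⁻¹ * {x | n⁻¹ ≤ d x}.indicator (fun x => (d x ^ S)⁻¹) x := by positivity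
          linarith
        · push Not at hxn
          rw [indicator_of_mem (show x ∈ {x | n⁻¹ ≤ d x} from hxn.le),
            indicator_of_notMem (show x ∉ {x | d x ≤ n⁻¹} from not_le.2 hxn), zero_add]
          exact hKd (lt_trans (by positivity) hxn)
      calc |K x| * |g x| ≤ _ * G₁ := mul_le_mul key hg (abs_nonneg _) (by positivity)
        _ ≤ F x := by
          rw [hF]; simp only
          have : 0 ≤ M * (G₂ * ((n ^ S)⁻¹ * {x | r ≤ d x}.indicator (fun x => (d x ^ S)⁻¹) x)) := by
            positivity
          linarith
    · push Not at hxr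
      have key := hKd (hr.trans_le hxr)
      rw [← indicator_of_mem (show x ∈ {x | r ≤ d x} from hxr) (fun x => (d x ^ S)⁻¹)] at key
      calc |K x| * |g x| ≤ _ * G₂ := mul_le_mul key (h2 x) (abs_nonneg _) (by positivity)
        _ ≤ F x := by
          rw [hF]; simp only
          have : 0 ≤ M * (G₁ * ({x | d x ≤ n⁻¹}.indicator (fun _ => (1 : ℝ)) x +
            (n ^ S)⁻¹ * {x | n⁻¹ ≤ d x}.indicator (fun x => (d x ^ S)⁻¹) x)) := by positivity
          linarith
  rw [← Real.norm_eq_abs]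
  refine (norm_integral_le_of_norm_le hFi (Eventually.of_forall hpt)).trans ?_
  have hval : ∫ x, F x ∂μ = M * (G₁ * (∫ x, {x | d x ≤ n⁻¹}.indicator (fun _ => (1 : ℝ)) x ∂μ +
    (n ^ S)⁻¹ * ∫ x, {x | n⁻¹ ≤ d x}.indicator (fun x => (d x ^ S)⁻¹) x ∂μ) +
    G₂ * ((n ^ S)⁻¹ * ∫ x, {x | r ≤ d x}.indicator (fun x => (d x ^ S)⁻¹) x ∂μ)) := by
    rw [hF, integral_const_mul, integral_add, integral_const_mul, integral_add, integral_const_mul,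
      integral_const_mul, integral_const_mul]
    · exact hi0
    · exact hi1.const_mul _
    · exact (hi0.add (hi1.const_mul _)).const_mul _
    · exact (hi2.const_mul _).const_mul _
  have e1 : n⁻¹ ^ q = n ^ (-q) := by rw [Real.inv_rpow hn.le, Real.rpow_neg hn.le]
  have e2 : (n ^ S)⁻¹ * n⁻¹ ^ (q - S) = n ^ (-q) := by
    rw [Real.inv_rpow hn.le, ← Real.rpow_neg hn.le, ← Real.rpow_natCast, ← Real.rpow_neg hn.le,
      ← Real.rpow_add hn]
    congr 1; ring
  have e3 : (n ^ S)⁻¹ = n ^ (-(S : ℝ)) := by rw [Real.rpow_neg hn.le, Real.rpow_natCast]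
  rw [hval]
  calc _ ≤ M * (G₁ * (c * n⁻¹ ^ q + (n ^ S)⁻¹ * (C * n⁻¹ ^ (q - S))) +
        G₂ * ((n ^ S)⁻¹ * (C * r ^ (q - S)))) := by gcongr
    _ = M * (G₁ * (c + C) * n ^ (-q) + G₂ * C * (n ^ (-(S : ℝ)) * r ^ (q - S))) := by
        have e4 : (n ^ S)⁻¹ * (C * n⁻¹ ^ (q - S)) = C * n ^ (-q) := by rw [← e2]; ring
        rw [← e3, e1, e4]; ring
    _ ≤ M * (G₁ * (c + C) * n ^ (-q) + G₂ * (c + C) * (n ^ (-(S : ℝ)) * r ^ (q - S))) := by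
        gcongr; linarith
    _ = _ := by ring

/-! ### The operators `σ_n` on a single data space -/

namespace DataSpace

variable {X : Type*} [MetricSpace X] [CompactSpace X] [MeasurableSpace X] [BorelSpace X]

theorem lam_nonneg (D : DataSpace X) (k : ℕ) : 0 ≤ D.lam k :=
  D.lam_zero ▸ D.lam_mono (Nat.zero_le k)

theorem finite_lam_lt (D : DataSpace X) (u : ℝ) : {k | D.lam k < u}.Finite := by
  obtain ⟨N, hN⟩ := (tendsto_atTop.1 D.lam_tendsto u).exists_forall_of_atTop
  refine (Set.finite_lt_nat N).subset fun k hk => ?_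
  by_contra hkN
  exact absurd (hN k (not_lt.1 hkN)) (not_le.2 hk)

/-- The diagonal heat kernel at time `1/n²` gives `∑_{λ_k<n} φ_k(x)² ≤ e κ₁ n^q`, since
`exp(-λ_k²/n²) ≥ 1/e` there. The inequality `2|ab| ≤ a² + b²` turns this into a variation bound for
`φ_k(x)φ_k(y)`, and localization applies with the diameter of `X` as distance bound. -/
theorem exists_kernel_localization (D : DataSpace X) {h : ℝ → ℝ} (hh : IsLowPassFilter h) :
    ∃ q κ : ℝ, 0 < q ∧ 0 < κ ∧
      (∀ x : X, ∀ ρ : ℝ, 0 < ρ → D.μ.real {y | dist x y ≤ ρ} ≤ κ * ρ ^ q) ∧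
      ∀ S : ℕ, ∃ C : ℝ, 0 < C ∧ ∀ n : ℝ, 1 ≤ n → ∀ x y : X,
        |D.kernel h n x y| * (1 + n * dist x y) ^ S ≤ C * n ^ q := by
  obtain ⟨q, κ, κ₁, κ₂, hq, hκ, hκ₁, hκ₂, hball, hheat⟩ := D.exists_exponent
  have hq0 : 0 < q := by linarith
  refine ⟨q, κ, hq0, hκ, fun x ρ hρ => ?_, fun S => ?_⟩
  · have := (hball x ρ hρ).2
    simpa only [Metric.closedBall, dist_comm] using this
  have hdiag : ∀ x : X, ∀ n : ℕ, 0 < n → ∀ s : Finset ℕ, (∀ i ∈ s, D.lam i < n) →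
      ∑ i ∈ s, D.phi i x ^ 2 ≤ Real.exp 1 * κ₁ * (n : ℝ) ^ q := by
    intro x n hn s hs
    have hnR : (0 : ℝ) < n := by exact_mod_cast hn
    have hn1 : (1 : ℝ) ≤ n := by exact_mod_cast hn
    obtain ⟨h1, h2⟩ := hheat x x (1 / (n : ℝ) ^ 2) (by positivity)
      (by rw [div_le_one (by positivity)]; nlinarith)
    have h3 : ∑ i ∈ s, D.phi i x ^ 2 ≤
        ∑ i ∈ s, Real.exp 1 * (Real.exp (-(D.lam i ^ 2 * (1 / (n : ℝ) ^ 2))) *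
          D.phi i x * D.phi i x) := by
      refine Finset.sum_le_sum fun i hi => ?_
      have h4 : 1 ≤ Real.exp 1 * Real.exp (-(D.lam i ^ 2 * (1 / (n : ℝ) ^ 2))) := by
        rw [← Real.exp_add]
        apply Real.one_le_exp
        have h5 : D.lam i ^ 2 ≤ (n : ℝ) ^ 2 := by
          have := D.lam_nonneg i; have := hs i hi
          gcongr
        have h6 : D.lam i ^ 2 * (1 / (n : ℝ) ^ 2) ≤ 1 := by
          rw [mul_one_div, div_le_one (by positivity)]; exact h5
        linarith
      calc D.phi i x ^ 2 ≤ Real.exp 1 * Real.exp (-(D.lam i ^ 2 * (1 / (n : ℝ) ^ 2))) *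
            D.phi i x ^ 2 := le_mul_of_one_le_left (sq_nonneg _) h4
        _ = _ := by ring
    have h7 : (1 / (n : ℝ) ^ 2) ^ (-q / 2) = (n : ℝ) ^ q := by
      rw [one_div, Real.inv_rpow (by positivity), neg_div, Real.rpow_neg (by positivity), inv_inv,
        ← Real.rpow_natCast, ← Real.rpow_mul hnR.le]
      congr 1; push_cast; ring
    rw [dist_self, h7] at h2
    rw [← Finset.mul_sum] at h3
    refine h3.trans ?_
    rw [mul_assoc]
    gcongr
    have h8 := h1.sum_le_tsum s (fun i _ => by
      rw [mul_assoc]; exact mul_nonneg (Real.exp_pos _).le (mul_self_nonneg _))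
    refine h8.trans ((le_abs_self _).trans (h2.trans ?_))
    norm_num
  obtain ⟨C, hC, H⟩ := VariationBound.exists_localization (l := D.lam) D.lam_nonneg hh
    (c := Real.exp 1 * κ₁) (c₀ := q / 2) (c₁ := κ₁) (by positivity) hq0 hκ₂
    (Metric.diam_nonneg (s := (univ : Set X))) S
  refine ⟨C, hC, fun n hn x y => ?_⟩
  have hvar : VariationBound D.lam (fun k => D.phi k x * D.phi k y) (Real.exp 1 * κ₁) q := by
    intro n hn s hs
    calc ∑ i ∈ s, |D.phi i x * D.phi i y|
        ≤ ∑ i ∈ s, (D.phi i x ^ 2 + D.phi i y ^ 2) / 2 := by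
          refine Finset.sum_le_sum fun i _ => abs_le.2 ⟨?_, ?_⟩
          · nlinarith [sq_nonneg (D.phi i x + D.phi i y)]
          · nlinarith [sq_nonneg (D.phi i x - D.phi i y)]
      _ = (∑ i ∈ s, D.phi i x ^ 2 + ∑ i ∈ s, D.phi i y ^ 2) / 2 := by
          rw [← Finset.sum_div, Finset.sum_add_distrib]
      _ ≤ _ := by linarith [hdiag x n hn s hs, hdiag y n hn s hs]
  have h1 := H _ hvar (dist x y) dist_nonneg
    (Metric.dist_le_diam_of_mem isCompact_univ.isBounded (mem_univ x) (mem_univ y))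
    (fun t ht ht1 => by
      have e : heatSum D.lam (fun k => D.phi k x * D.phi k y) t =
          ((∑' k, Real.exp (-(D.lam k ^ 2 * t)) * D.phi k x * D.phi k y : ℝ) : ℂ) := by
        rw [heatSum, Complex.ofReal_tsum]
        congr 1; ext k
        push_cast; ring
      rw [e, Complex.norm_real, Real.norm_eq_abs, ← neg_div]
      exact (hheat x y t ht ht1).2) n hn
  simpa only [kernel, mul_assoc] using h1

theorem finite_support_filter (D : DataSpace X) {h : ℝ → ℝ} (hh : IsLowPassFilter h) {n : ℝ}
    (hn : 0 < n) {k : ℕ} (hk : k ∉ (D.finite_lam_lt n).toFinset) : h (D.lam k / n) = 0 := by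
  rw [Set.Finite.mem_toFinset, mem_ofPred_eq, not_lt] at hk
  exact hh.eq_zero _ ((one_le_div hn).2 hk)

theorem kernel_eq_sum (D : DataSpace X) {h : ℝ → ℝ} (hh : IsLowPassFilter h) {n : ℝ}
    (hn : 0 < n) (x y : X) :
    D.kernel h n x y =
      ∑ k ∈ (D.finite_lam_lt n).toFinset, h (D.lam k / n) * D.phi k x * D.phi k y :=
  tsum_eq_sum fun k hk => by rw [D.finite_support_filter hh hn hk]; ring

theorem integrable_of_continuous (D : DataSpace X) {g : X → ℝ} (hg : Continuous g) :
    Integrable g D.μ := by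
  have := D.isProb
  exact hg.integrable_of_hasCompactSupport (HasCompactSupport.of_compactSpace g)

/-- The operator `σ_n` with values in the continuous functions. -/
def sigmaC (D : DataSpace X) (h : ℝ → ℝ) (n : ℝ) (f : C(X, ℝ)) : C(X, ℝ) :=
  ∑ k ∈ (D.finite_lam_lt n).toFinset, (h (D.lam k / n) * ∫ y, D.phi k y * f y ∂D.μ) • D.phi k

theorem sigmaC_apply (D : DataSpace X) {h : ℝ → ℝ} (hh : IsLowPassFilter h) {n : ℝ}
    (hn : 0 < n) (f : C(X, ℝ)) (x : X) : D.sigmaC h n f x = D.sigma h n f x := by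
  simp only [sigma, D.kernel_eq_sum hh hn, Finset.sum_mul]
  rw [integral_finsetSum _ fun k _ => D.integrable_of_continuous (by fun_prop)]
  simp only [sigmaC, ContinuousMap.sum_apply, ContinuousMap.smul_apply, smul_eq_mul]
  refine Finset.sum_congr rfl fun k _ => ?_
  rw [mul_right_comm, ← integral_const_mul]
  congr 1; ext y; ring

theorem sigmaC_mem (D : DataSpace X) (h : ℝ → ℝ) (n : ℝ) (f : C(X, ℝ)) :
    D.sigmaC h n f ∈ D.diffPoly n :=
  Submodule.sum_mem _ fun k hk => Submodule.smul_mem _ _ (Submodule.subset_span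
    ⟨k, (Set.Finite.mem_toFinset _).1 hk, rfl⟩)

theorem sigmaC_sub (D : DataSpace X) (h : ℝ → ℝ) (n : ℝ) (f g : C(X, ℝ)) :
    D.sigmaC h n (f - g) = D.sigmaC h n f - D.sigmaC h n g := by
  simp only [sigmaC]
  rw [← Finset.sum_sub_distrib]
  refine Finset.sum_congr rfl fun k _ => ?_
  rw [← sub_smul, ← mul_sub, ← integral_sub]
  · simp only [ContinuousMap.sub_apply, mul_sub]
  · exact D.integrable_of_continuous (by fun_prop)
  · exact D.integrable_of_continuous (by fun_prop)

theorem diffPoly_mono (D : DataSpace X) {m n : ℝ} (hmn : m ≤ n) : D.diffPoly m ≤ D.diffPoly n :=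
  Submodule.span_mono (image_mono fun _ hk => lt_of_lt_of_le hk hmn)

theorem sigmaC_eq_self (D : DataSpace X) {h : ℝ → ℝ} (hh : IsLowPassFilter h) {n : ℝ}
    (hn : 0 < n) {P : C(X, ℝ)} (hP : P ∈ D.diffPoly (n / 2)) : D.sigmaC h n P = P := by
  classical
  induction hP using Submodule.span_induction with
  | mem P hP =>
    obtain ⟨k, hk, rfl⟩ := hP
    have hk' : D.lam k < n / 2 := hk
    have hkn : k ∈ (D.finite_lam_lt n).toFinset := by
      rw [Set.Finite.mem_toFinset]; show D.lam k < n; linarith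
    simp only [sigmaC, D.orthonormal]
    rw [Finset.sum_eq_single_of_mem k hkn]
    · rw [hh.eq_one _ (div_nonneg (D.lam_nonneg k) hn.le)
        (by rw [div_le_iff₀ hn]; linarith)]
      simp
    · intro j _ hj; simp [hj]
  | zero =>
    have := D.sigmaC_sub h n 0 0
    simpa using this
  | add P R _ _ hP hR =>
    have h1 := D.sigmaC_sub h n (P + R) R
    rw [add_sub_cancel_right, hP, hR] at h1
    exact (sub_eq_iff_eq_add.1 h1.symm)
  | smul a P _ hP =>
    have : D.sigmaC h n (a • P) = a • D.sigmaC h n P := by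
      simp only [sigmaC, Finset.smul_sum]
      refine Finset.sum_congr rfl fun k _ => ?_
      have e : ∫ y, D.phi k y * (a • P) y ∂D.μ = a * ∫ y, D.phi k y * P y ∂D.μ := by
        rw [← integral_const_mul]
        refine integral_congr_ae (Eventually.of_forall fun y => ?_)
        simp only [ContinuousMap.smul_apply, smul_eq_mul]; ring
      rw [e, smul_smul, mul_left_comm]
    rw [this, hP]

end DataSpace

/-! ### Approximation and local smoothness -/

namespace DataSpace

variable {X : Type*} [MetricSpace X] [CompactSpace X] [MeasurableSpace X] [BorelSpace X]

/-- The kernel is localized to every order, so an order `S ≥ q + β` makes the contribution of the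
values at distance at least `r` as small as `n^(-β)`. The exponent `p` is `q - S`. -/
theorem exists_sigmaC_bound (D : DataSpace X) {h : ℝ → ℝ} (hh : IsLowPassFilter h) (β : ℝ) :
    ∃ (C : ℝ) (p : ℝ), 0 < C ∧ ∀ (n r G : ℝ) (f : C(X, ℝ)) (x : X), 1 ≤ n → 0 < r → 0 ≤ G →
      (∀ y, dist x y < r → |f y| ≤ G) →
      |D.sigmaC h n f x| ≤ C * (G + n ^ (-β) * r ^ p * ‖f‖) := by
  have := D.isProb
  obtain ⟨q, κ, hq, hκ, hball, hloc⟩ := D.exists_kernel_localization hh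
  obtain ⟨S, hS⟩ := exists_nat_gt (q + max β 0)
  have hSq : q < S := by linarith [le_max_right β 0]
  have hSβ : q + β ≤ S := by linarith [le_max_left β 0]
  obtain ⟨C₁, hC₁, H₁⟩ := hloc S
  obtain ⟨C₂, hC₂, H₂⟩ := exists_integral_kernel_bound D.μ hκ hSq
  refine ⟨C₂ * C₁, q - S, by positivity, fun n r G f x hn hr hG hf => ?_⟩
  have hn0 : 0 < n := by linarith
  rw [D.sigmaC_apply hh hn0]
  have h1 := H₂ (fun y => dist x y) (by fun_prop) (fun y => dist_nonneg) (hball x) n r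
    (C₁ * n ^ q) G ‖f‖ hn0 hr (by positivity) hG (norm_nonneg f) (D.kernel h n x) f
    (H₁ n hn x) hf (fun y => f.norm_coe_le_norm y)
  refine h1.trans ?_
  have e1 : n ^ q * n ^ (-q) = 1 := by rw [← Real.rpow_add hn0]; simp
  have e2 : n ^ q * n ^ (-(S : ℝ)) ≤ n ^ (-β) := by
    rw [← Real.rpow_add hn0]
    exact Real.rpow_le_rpow_of_exponent_le hn (by linarith)
  calc _ = C₂ * C₁ * ((n ^ q * n ^ (-q)) * G + (n ^ q * n ^ (-(S : ℝ))) * r ^ (q - S) * ‖f‖) := by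
        ring
    _ ≤ _ := by rw [e1, one_mul]; gcongr

theorem exists_norm_sigmaC_le (D : DataSpace X) {h : ℝ → ℝ} (hh : IsLowPassFilter h) :
    ∃ C : ℝ, 0 < C ∧ ∀ n : ℝ, 1 ≤ n → ∀ f : C(X, ℝ), ‖D.sigmaC h n f‖ ≤ C * ‖f‖ := by
  obtain ⟨C, p, hC, H⟩ := D.exists_sigmaC_bound hh 0
  refine ⟨2 * C, by positivity, fun n hn f => ?_⟩
  refine (ContinuousMap.norm_le _ (by positivity)).2 fun x => ?_
  have := H n 1 ‖f‖ f x hn one_pos (norm_nonneg f) fun y _ => f.norm_coe_le_norm y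
  rw [neg_zero, Real.rpow_zero, Real.one_rpow] at this
  rw [Real.norm_eq_abs]
  linarith

/-- Far from the support of `f`, `σ_n f` is smaller than any power of `n`. -/
theorem exists_sigmaC_far_bound (D : DataSpace X) {h : ℝ → ℝ} (hh : IsLowPassFilter h) (β : ℝ)
    {r : ℝ} (hr : 0 < r) :
    ∃ C : ℝ, 0 < C ∧ ∀ (n : ℝ) (f : C(X, ℝ)) (x : X), 1 ≤ n → (∀ y, dist x y < r → f y = 0) →
      |D.sigmaC h n f x| ≤ C * ‖f‖ * n ^ (-β) := by
  obtain ⟨C, p, hC, H⟩ := D.exists_sigmaC_bound hh β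
  refine ⟨C * r ^ p, by positivity, fun n f x hn hf => ?_⟩
  have := H n r 0 f x hn hr le_rfl fun y hy => by rw [hf y hy, abs_zero]
  refine this.trans (le_of_eq ?_)
  ring

/-- For `P ∈ Π_{n/2}`, `f - σ_n f = (f - P) - σ_n(f - P)`, and the `σ_n` are uniformly bounded. -/
theorem exists_norm_sub_sigmaC_le (D : DataSpace X) {h : ℝ → ℝ} (hh : IsLowPassFilter h) :
    ∃ C : ℝ, 0 < C ∧ ∀ n : ℝ, 1 ≤ n → ∀ f : C(X, ℝ),
      ‖f - D.sigmaC h n f‖ ≤ C * D.degApprox (n / 2) f := by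
  obtain ⟨C, hC, H⟩ := D.exists_norm_sigmaC_le hh
  refine ⟨1 + C, by positivity, fun n hn f => ?_⟩
  rw [← div_le_iff₀' (by positivity), degApprox, Metric.le_infDist ⟨0, Submodule.zero_mem _⟩]
  intro P hP
  rw [div_le_iff₀' (by positivity), dist_eq_norm]
  have h1 : f - D.sigmaC h n f = (f - P) - D.sigmaC h n (f - P) := by
    rw [D.sigmaC_sub, D.sigmaC_eq_self hh (by linarith) hP]; abel
  rw [h1]
  refine (norm_sub_le _ _).trans ?_
  have := H n hn (f - P)
  linarith

theorem mem_W_iff (D : DataSpace X) {γ : ℝ} {f : C(X, ℝ)} :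
    f ∈ D.W γ ↔ ∃ C : ℝ, ∀ n : ℝ, 0 < n → n ^ γ * D.degApprox n f ≤ C := by
  constructor
  · rintro ⟨C, hC⟩
    exact ⟨C, fun n hn => hC ⟨n, hn, rfl⟩⟩
  · rintro ⟨C, hC⟩
    exact ⟨C, by rintro _ ⟨n, hn, rfl⟩; exact hC n hn⟩

theorem degApprox_nonneg (D : DataSpace X) (n : ℝ) (f : C(X, ℝ)) : 0 ≤ D.degApprox n f :=
  Metric.infDist_nonneg

theorem degApprox_le (D : DataSpace X) {n : ℝ} {f P : C(X, ℝ)} (hP : P ∈ D.diffPoly n) :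
    D.degApprox n f ≤ ‖f - P‖ := by
  rw [← dist_eq_norm]
  exact Metric.infDist_le_dist_of_mem hP

theorem exists_mem_diffPoly_lt (D : DataSpace X) {n b : ℝ} {f : C(X, ℝ)}
    (hb : D.degApprox n f < b) : ∃ P ∈ D.diffPoly n, ‖f - P‖ < b := by
  obtain ⟨P, hP, h⟩ := (Metric.infDist_lt_iff ⟨0, Submodule.zero_mem _⟩).1 hb
  exact ⟨P, hP, by rwa [← dist_eq_norm]⟩

theorem degApprox_add_le (D : DataSpace X) (n : ℝ) (f g : C(X, ℝ)) :
    D.degApprox n (f + g) ≤ D.degApprox n f + D.degApprox n g := by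
  refine le_of_forall_pos_lt_add fun ε hε => ?_
  obtain ⟨P, hP, h1⟩ := D.exists_mem_diffPoly_lt (show D.degApprox n f < D.degApprox n f + ε / 2 by
    linarith)
  obtain ⟨R, hR, h2⟩ := D.exists_mem_diffPoly_lt (show D.degApprox n g < D.degApprox n g + ε / 2 by
    linarith)
  calc _ ≤ ‖f + g - (P + R)‖ := D.degApprox_le (Submodule.add_mem _ hP hR)
    _ = ‖(f - P) + (g - R)‖ := by congr 1; abel
    _ ≤ ‖f - P‖ + ‖g - R‖ := norm_add_le _ _
    _ < _ := by linarith

theorem W_add (D : DataSpace X) {γ : ℝ} {f g : C(X, ℝ)} (hf : f ∈ D.W γ) (hg : g ∈ D.W γ) :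
    f + g ∈ D.W γ := by
  obtain ⟨C, hC⟩ := D.mem_W_iff.1 hf
  obtain ⟨C', hC'⟩ := D.mem_W_iff.1 hg
  refine D.mem_W_iff.2 ⟨C + C', fun n hn => ?_⟩
  calc _ ≤ n ^ γ * (D.degApprox n f + D.degApprox n g) := by
        gcongr; exact D.degApprox_add_le n f g
    _ ≤ _ := by rw [mul_add]; exact add_le_add (hC n hn) (hC' n hn)

theorem W_zero (D : DataSpace X) {γ : ℝ} : (0 : C(X, ℝ)) ∈ D.W γ := by
  refine D.mem_W_iff.2 ⟨0, fun n hn => ?_⟩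
  have h1 : D.degApprox n 0 ≤ 0 := by
    simpa using D.degApprox_le (f := 0) (Submodule.zero_mem (D.diffPoly n))
  exact mul_nonpos_of_nonneg_of_nonpos (by positivity) h1

theorem smooth_sum (D : DataSpace X) {F : Finset ℕ} {ψ : ℕ → C(X, ℝ)}
    (hψ : ∀ k, ψ k ∈ D.smooth) : ∑ k ∈ F, ψ k ∈ D.smooth := fun _ hγ =>
  Finset.sum_induction _ (· ∈ D.W _) (fun _ _ => D.W_add) D.W_zero fun k _ => hψ k _ hγ

/-- At scale `ρ/3`, keep the members that do not vanish identically on `𝔹(x, ρ/3)`. The sum there is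
unchanged, and each is supported in a ball of radius `ρ/3` meeting `𝔹(x, ρ/3)`, hence within `ρ` of
`x`. -/
theorem HasPartitionOfUnity.exists_local_unit {D : DataSpace X} (hD : D.HasPartitionOfUnity)
    (x : X) {ρ : ℝ} (hρ : 0 < ρ) :
    ∃ u ∈ D.smoothOn (Metric.closedBall x ρ), ∀ y, dist x y ≤ ρ / 3 → u y = 1 := by
  classical
  obtain ⟨ψ, hψ, hsupp, -, N, hN⟩ := hD (ρ / 3) (by positivity)
  obtain ⟨F, -, hF⟩ := hN x
  set F' := F.filter fun k => ∃ y ∈ Metric.closedBall x (ρ / 3), ψ k y ≠ 0 with hF'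
  refine ⟨∑ k ∈ F', ψ k, ⟨D.smooth_sum hψ, fun y hy => ?_⟩, fun y hy => ?_⟩
  · rw [Function.mem_support, ContinuousMap.sum_apply] at hy
    obtain ⟨k, hk, hky⟩ := Finset.exists_ne_zero_of_sum_ne_zero hy
    obtain ⟨-, w, hw, hkw⟩ := Finset.mem_filter.1 hk
    obtain ⟨z, hz⟩ := hsupp k
    have h1 : dist y z ≤ ρ / 3 := hz hky
    have h2 : dist w z ≤ ρ / 3 := hz hkw
    have h3 : dist w x ≤ ρ / 3 := hw
    rw [Metric.mem_closedBall]
    have h4 := dist_triangle4 y z w x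
    rw [dist_comm z w] at h4
    linarith
  · have hy' : y ∈ Metric.closedBall x (ρ / 3) := by rwa [Metric.mem_closedBall, dist_comm]
    rw [ContinuousMap.sum_apply, ← hF y hy', hF']
    refine Finset.sum_filter_of_ne fun k _ hk => ⟨y, hy', hk⟩

theorem exists_norm_sub_sigmaC_le_rpow (D : DataSpace X) {h : ℝ → ℝ} (hh : IsLowPassFilter h)
    {γ : ℝ} {f : C(X, ℝ)} (hf : f ∈ D.W γ) :
    ∃ C : ℝ, 0 ≤ C ∧ ∀ n : ℝ, 1 ≤ n → ‖f - D.sigmaC h n f‖ ≤ C * n ^ (-γ) := by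
  obtain ⟨C₁, hC₁, H₁⟩ := D.exists_norm_sub_sigmaC_le hh
  obtain ⟨C₂, H₂⟩ := D.mem_W_iff.1 hf
  have hC₂ : 0 ≤ C₂ := le_trans (mul_nonneg (by positivity) (D.degApprox_nonneg 1 f)) (H₂ 1 one_pos)
  refine ⟨C₁ * (C₂ * 2 ^ γ), by positivity, fun n hn => ?_⟩
  have hn0 : 0 < n := by linarith
  have h1 := H₂ (n / 2) (by positivity)
  rw [← le_div_iff₀' (by positivity)] at h1
  calc _ ≤ C₁ * D.degApprox (n / 2) f := H₁ n hn f
    _ ≤ C₁ * (C₂ / (n / 2) ^ γ) := by gcongr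
    _ = _ := by
      rw [Real.div_rpow hn0.le two_pos.le, Real.rpow_neg hn0.le]; field_simp

/-- Neither density of the diffusion polynomials nor constants among them is assumed. Near `x₀`
split `1 = u + (1 - u)` with a smooth local unit `u`: `σ_n u → u` by smoothness and `σ_n(1 - u) → 0`
by localization, so `σ_n 1 → 1` there. Localization and uniform continuity make `σ_n(f - f(x))(x)`
small. -/
theorem HasPartitionOfUnity.tendsto_sigmaC {D : DataSpace X} (hD : D.HasPartitionOfUnity)
    {h : ℝ → ℝ} (hh : IsLowPassFilter h) (f : C(X, ℝ)) :
    Tendsto (fun n : ℝ => D.sigmaC h n f) atTop (𝓝 f) := by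
  obtain ⟨C₁, p, hC₁, H₁⟩ := D.exists_sigmaC_bound hh 1
  rw [ContinuousMap.tendsto_iff_tendstoLocallyUniformly, Metric.tendstoLocallyUniformly_iff]
  intro ε hε x₀
  obtain ⟨u, hu, hu1⟩ := hD.exists_local_unit x₀ one_pos
  obtain ⟨C₂, hC₂, H₂⟩ := D.exists_norm_sub_sigmaC_le_rpow hh (hu.1 1 one_pos)
  -- The local unit equals `1` within `1/3` of `x₀`. For `x` within `1/6` of `x₀`, the function `1 -
  -- u` vanishes within `1/6` of `x`.
  obtain ⟨C₃, hC₃, H₃⟩ := D.exists_sigmaC_far_bound hh 1 (show (0 : ℝ) < 1 / 6 by norm_num)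
  set ε' := ε / (2 * C₁) with hε'
  have hε'0 : 0 < ε' := by positivity
  obtain ⟨δ, hδ, hδf⟩ := Metric.uniformContinuous_iff.1
    (CompactSpace.uniformContinuous_of_continuous f.continuous) ε' hε'0
  set K := ‖f‖ * (C₂ + C₃ * ‖1 - u‖) + C₁ * δ ^ p * (2 * ‖f‖) with hK
  have hlim : Tendsto (fun n : ℝ => K * n ^ (-1 : ℝ)) atTop (𝓝 0) := by
    simpa using (tendsto_rpow_neg_atTop one_pos).const_mul K
  refine ⟨Metric.ball x₀ (1 / 6), Metric.ball_mem_nhds _ (by norm_num), ?_⟩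
  filter_upwards [hlim.eventually (gt_mem_nhds (half_pos hε)), eventually_ge_atTop 1] with n hnK hn x hx
  rw [Metric.mem_ball, dist_comm] at hx
  have hux : u x = 1 := hu1 x (by linarith)
  have a1 : |u x - D.sigmaC h n u x| ≤ C₂ * n ^ (-1 : ℝ) :=
    ((u - D.sigmaC h n u).norm_coe_le_norm x).trans (H₂ n hn)
  have a2 : |D.sigmaC h n (1 - u) x| ≤ C₃ * ‖1 - u‖ * n ^ (-1 : ℝ) := by
    refine H₃ n (1 - u) x hn fun y hy => ?_
    rw [ContinuousMap.sub_apply, ContinuousMap.one_apply, hu1 y, sub_self]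
    linarith [dist_triangle x₀ x y]
  set g : C(X, ℝ) := f - f x • (1 : C(X, ℝ)) with hg
  have hgn : ‖g‖ ≤ 2 * ‖f‖ := by
    refine (ContinuousMap.norm_le _ (by positivity)).2 fun y => ?_
    have b1 := f.norm_coe_le_norm y
    have b2 := f.norm_coe_le_norm x
    calc ‖g y‖ = ‖f y - f x‖ := by simp [hg]
      _ ≤ ‖f y‖ + ‖f x‖ := norm_sub_le _ _
      _ ≤ _ := by linarith
  have a3 : |D.sigmaC h n g x| ≤ C₁ * (ε' + n ^ (-1 : ℝ) * δ ^ p * ‖g‖) := by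
    refine H₁ n δ ε' g x hn hδ hε'0.le fun y hy => ?_
    have : g y = f y - f x := by simp [hg]
    rw [this, ← Real.dist_eq, dist_comm]
    exact (hδf hy).le
  have hsmul : D.sigmaC h n (f x • (1 : C(X, ℝ))) = f x • D.sigmaC h n 1 := by
    simp only [sigmaC, Finset.smul_sum]
    refine Finset.sum_congr rfl fun k _ => ?_
    have e : ∫ y, D.phi k y * (f x • (1 : C(X, ℝ))) y ∂D.μ
        = f x * ∫ y, D.phi k y * (1 : C(X, ℝ)) y ∂D.μ := by
      rw [← integral_const_mul]
      refine integral_congr_ae (Eventually.of_forall fun y => ?_)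
      simp
      ring
    rw [e, smul_smul, mul_left_comm]
  have hid : f x - D.sigmaC h n f x =
      f x * ((u x - D.sigmaC h n u x) - D.sigmaC h n (1 - u) x) - D.sigmaC h n g x := by
    rw [hg, D.sigmaC_sub, D.sigmaC_sub, hsmul, hux]
    simp only [ContinuousMap.sub_apply, ContinuousMap.smul_apply, smul_eq_mul]
    ring
  rw [Real.dist_eq, hid]
  have hfx : |f x| ≤ ‖f‖ := f.norm_coe_le_norm x
  have hn1 : (0 : ℝ) ≤ n ^ (-1 : ℝ) := by positivity
  have hδp : (0 : ℝ) ≤ δ ^ p := by positivity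
  have hCε : C₁ * ε' = ε / 2 := by rw [hε']; field_simp
  calc _ ≤ |f x| * (|u x - D.sigmaC h n u x| + |D.sigmaC h n (1 - u) x|) + |D.sigmaC h n g x| := by
        refine (abs_sub _ _).trans ?_
        rw [abs_mul]
        gcongr
        exact abs_sub _ _
    _ ≤ ‖f‖ * (C₂ * n ^ (-1 : ℝ) + C₃ * ‖1 - u‖ * n ^ (-1 : ℝ)) +
        C₁ * (ε' + n ^ (-1 : ℝ) * δ ^ p * (2 * ‖f‖)) := by
        gcongr
        exact a3.trans (by gcongr)
    _ = K * n ^ (-1 : ℝ) + C₁ * ε' := by rw [hK]; ring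
    _ < ε := by rw [hCε]; linarith

/-- Split `f = uf + (1 - u)f` with a smooth unit `u` near a point of `A`. The first part lies in
`W_γ`, and the second vanishes near the point, so `σ_n` of it is there as small as any power of `n`.
Compactness of `A` makes the constant uniform. -/
theorem HasPartitionOfUnity.exists_abs_sub_sigmaC_le_of_mem_WOn {D : DataSpace X}
    (hD : D.HasPartitionOfUnity) {h : ℝ → ℝ} (hh : IsLowPassFilter h) {γ : ℝ} {A : Set X}
    (hA : IsCompact A) {f : C(X, ℝ)} (hf : f ∈ D.WOn γ A) :
    ∃ C : ℝ, 0 ≤ C ∧ ∀ n : ℝ, 1 ≤ n → ∀ x ∈ A, |f x - D.sigmaC h n f x| ≤ C * n ^ (-γ) := by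
  refine hA.induction_on (p := fun s => ∃ C : ℝ, 0 ≤ C ∧ ∀ n : ℝ, 1 ≤ n → ∀ x ∈ s,
    |f x - D.sigmaC h n f x| ≤ C * n ^ (-γ)) ⟨0, le_rfl, fun _ _ _ h => h.elim⟩ ?_ ?_ ?_
  · rintro s t hst ⟨C, hC, H⟩
    exact ⟨C, hC, fun n hn x hx => H n hn x (hst hx)⟩
  · rintro s t ⟨C, hC, H⟩ ⟨C', hC', H'⟩
    refine ⟨max C C', hC.trans (le_max_left _ _), fun n hn x hx => ?_⟩
    rcases hx with hx | hx
    · refine (H n hn x hx).trans ?_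
      gcongr
      exact le_max_left _ _
    · refine (H' n hn x hx).trans ?_
      gcongr
      exact le_max_right _ _
  · intro x₀ hx₀
    obtain ⟨ρ, hρ, hρf⟩ := hf x₀ hx₀
    obtain ⟨u, hu, hu1⟩ := hD.exists_local_unit x₀ hρ
    obtain ⟨C₁, hC₁, H₁⟩ := D.exists_norm_sub_sigmaC_le_rpow hh (hρf u hu)
    obtain ⟨C₂, hC₂, H₂⟩ := D.exists_sigmaC_far_bound hh γ (show 0 < ρ / 6 by positivity)
    refine ⟨Metric.ball x₀ (ρ / 6), mem_nhdsWithin_of_mem_nhds (Metric.ball_mem_nhds _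
      (by positivity)), C₁ + C₂ * ‖f - u * f‖, by positivity, fun n hn x hx => ?_⟩
    rw [Metric.mem_ball, dist_comm] at hx
    have hux : u x = 1 := hu1 x (by linarith)
    have a1 : |(u * f) x - D.sigmaC h n (u * f) x| ≤ C₁ * n ^ (-γ) :=
      ((u * f - D.sigmaC h n (u * f)).norm_coe_le_norm x).trans (H₁ n hn)
    have a2 : |D.sigmaC h n (f - u * f) x| ≤ C₂ * ‖f - u * f‖ * n ^ (-γ) := by
      refine H₂ n (f - u * f) x hn fun y hy => ?_
      rw [ContinuousMap.sub_apply, ContinuousMap.mul_apply, hu1 y, one_mul, sub_self]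
      linarith [dist_triangle x₀ x y]
    have hid : f x - D.sigmaC h n f x =
        ((u * f) x - D.sigmaC h n (u * f) x) - D.sigmaC h n (f - u * f) x := by
      rw [D.sigmaC_sub, ContinuousMap.sub_apply, ContinuousMap.mul_apply, hux]; ring
    rw [hid, add_mul]
    exact (abs_sub _ _).trans (add_le_add a1 a2)

end DataSpace

/-! ### Joint kernels and operators -/

namespace JointData

variable {X₁ X₂ : Type*}
  [MetricSpace X₁] [CompactSpace X₁] [MeasurableSpace X₁] [BorelSpace X₁]
  [MetricSpace X₂] [CompactSpace X₂] [MeasurableSpace X₂] [BorelSpace X₂]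

theorem finite_L_lt (J : JointData X₁ X₂) (u : ℝ) : {p : ℕ × ℕ | J.L p.1 p.2 < u}.Finite :=
  (J.L_finite (max u 1) (by positivity)).subset fun p hp =>
    show J.L p.1 p.2 < max u 1 from lt_of_lt_of_le hp (le_max_left _ _)

theorem mem_toFinset_L_lt (J : JointData X₁ X₂) {u : ℝ} {p : ℕ × ℕ} :
    p ∈ (J.finite_L_lt u).toFinset ↔ J.L p.1 p.2 < u := by simp

theorem filter_eq_zero (J : JointData X₁ X₂) {h : ℝ → ℝ} (hh : IsLowPassFilter h) {n : ℝ}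
    (hn : 0 < n) {p : ℕ × ℕ} (hp : p ∉ (J.finite_L_lt n).toFinset) : h (J.L p.1 p.2 / n) = 0 := by
  rw [Set.Finite.mem_toFinset, mem_ofPred_eq, not_lt] at hp
  exact hh.eq_zero _ ((one_le_div hn).2 hp)

theorem kernel_eq_sum (J : JointData X₁ X₂) {h : ℝ → ℝ} (hh : IsLowPassFilter h) {n : ℝ}
    (hn : 0 < n) (x₁ : X₁) (x₂ : X₂) :
    J.kernel h n x₁ x₂ = ∑ p ∈ (J.finite_L_lt n).toFinset,
      h (J.L p.1 p.2 / n) * J.A p.1 p.2 * J.Ξ₁.phi p.1 x₁ * J.Ξ₂.phi p.2 x₂ :=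
  tsum_eq_sum fun p hp => by rw [J.filter_eq_zero hh hn hp]; ring

/-- The joint operator `σ_n` with values in the continuous functions. -/
def sigmaC (J : JointData X₁ X₂) (h : ℝ → ℝ) (n : ℝ) (f : C(X₂, ℝ)) : C(X₁, ℝ) :=
  ∑ p ∈ (J.finite_L_lt n).toFinset,
    (h (J.L p.1 p.2 / n) * J.A p.1 p.2 * ∫ y, f y * J.Ξ₂.phi p.2 y ∂J.Ξ₂.μ) • J.Ξ₁.phi p.1

theorem sigmaC_apply (J : JointData X₁ X₂) {h : ℝ → ℝ} (hh : IsLowPassFilter h) {n : ℝ}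
    (hn : 0 < n) (f : C(X₂, ℝ)) (x : X₁) : J.sigmaC h n f x = J.sigma h n f x := by
  simp only [sigma, J.kernel_eq_sum hh hn, Finset.mul_sum]
  rw [integral_finsetSum _ fun k _ => J.Ξ₂.integrable_of_continuous (by fun_prop)]
  simp only [sigmaC, ContinuousMap.sum_apply, ContinuousMap.smul_apply, smul_eq_mul]
  refine Finset.sum_congr rfl fun k _ => ?_
  rw [mul_right_comm, ← integral_const_mul]
  congr 1; ext y; ring

theorem sigmaC_mem (J : JointData X₁ X₂) (h : ℝ → ℝ) {α : ℝ} (hα : 0 < α)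
    (hL : ∀ j k, J.Ξ₁.lam j ≤ α * J.L j k) (n : ℝ) (f : C(X₂, ℝ)) :
    J.sigmaC h n f ∈ J.Ξ₁.diffPoly (α * n) :=
  Submodule.sum_mem _ fun p hp => Submodule.smul_mem _ _ (Submodule.subset_span
    ⟨p.1, lt_of_le_of_lt (hL _ _)
      (mul_lt_mul_of_pos_left (J.mem_toFinset_L_lt.1 hp) hα), rfl⟩)

theorem sigmaC_sub (J : JointData X₁ X₂) (h : ℝ → ℝ) (n : ℝ) (f g : C(X₂, ℝ)) :
    J.sigmaC h n (f - g) = J.sigmaC h n f - J.sigmaC h n g := by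
  simp only [sigmaC]
  rw [← Finset.sum_sub_distrib]
  refine Finset.sum_congr rfl fun k _ => ?_
  rw [← sub_smul, ← mul_sub, ← integral_sub]
  · simp only [ContinuousMap.sub_apply, sub_mul]
  · exact J.Ξ₂.integrable_of_continuous (by fun_prop)
  · exact J.Ξ₂.integrable_of_continuous (by fun_prop)

theorem sigma_sub (J : JointData X₁ X₂) {h : ℝ → ℝ} (hh : IsLowPassFilter h) {n : ℝ}
    (hn : 0 < n) (f g : C(X₂, ℝ)) (x : X₁) :
    J.sigma h n (f - g) x = J.sigma h n f x - J.sigma h n g x := by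
  rw [← J.sigmaC_apply hh hn, sigmaC_sub, ContinuousMap.sub_apply, J.sigmaC_apply hh hn,
    J.sigmaC_apply hh hn]

theorem continuous_d_right (J : JointData X₁ X₂) (x₁ : X₁) : Continuous (J.d x₁) := by
  refine (LipschitzWith.of_dist_le_mul (K := 1) fun y z => ?_).continuous
  rw [Real.dist_eq, NNReal.coe_one, one_mul, abs_sub_le_iff]
  have h1 := J.d_triangle_right x₁ y z
  have h2 := J.d_triangle_right x₁ z y
  rw [dist_comm z y] at h1
  constructor <;> linarith

theorem exists_d_le (J : JointData X₁ X₂) : ∃ D : ℝ, 0 ≤ D ∧ ∀ x₁ x₂, J.d x₁ x₂ ≤ D := by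
  rcases isEmpty_or_nonempty X₁ with h1 | ⟨⟨y₁⟩⟩
  · exact ⟨0, le_rfl, fun x => h1.elim x⟩
  rcases isEmpty_or_nonempty X₂ with h2 | ⟨⟨y₂⟩⟩
  · exact ⟨0, le_rfl, fun _ x => h2.elim x⟩
  refine ⟨Metric.diam (univ : Set X₁) + J.d y₁ y₂ + Metric.diam (univ : Set X₂), ?_,
    fun x₁ x₂ => ?_⟩
  · have := J.d_nonneg y₁ y₂
    have := Metric.diam_nonneg (s := (univ : Set X₁))
    have := Metric.diam_nonneg (s := (univ : Set X₂))
    linarith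
  · have e1 := J.d_triangle_left x₁ y₁ x₂
    have e2 := J.d_triangle_right y₁ x₂ y₂
    have e3 := Metric.dist_le_diam_of_mem isCompact_univ.isBounded (mem_univ x₁) (mem_univ y₁)
    have e4 := Metric.dist_le_diam_of_mem isCompact_univ.isBounded (mem_univ y₂) (mem_univ x₂)
    linarith

theorem IsJointDataSpace.exists_variationBound {J : JointData X₁ X₂} {Q q₁ q₂ : ℝ}
    (hJ : J.IsJointDataSpace Q q₁ q₂) :
    ∃ c : ℝ, 0 < c ∧ ∀ x₁ x₂, VariationBound (fun p : ℕ × ℕ => J.L p.1 p.2)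
      (fun p => J.A p.1 p.2 * J.Ξ₁.phi p.1 x₁ * J.Ξ₂.phi p.2 x₂) c Q := by
  obtain ⟨c, hc, H⟩ := hJ.variation
  refine ⟨c, hc, fun x₁ x₂ n hn s hs => le_trans ?_ (H n hn x₁ x₂)⟩
  have e := finsum_mem_eq_finite_toFinset_sum
    (fun p : ℕ × ℕ => |J.A p.1 p.2 * J.Ξ₁.phi p.1 x₁ * J.Ξ₂.phi p.2 x₂|) (J.finite_L_lt n)
  simp only [mem_ofPred_eq] at e
  rw [e]
  exact Finset.sum_le_sum_of_subset_of_nonneg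
    (fun p hp => (Set.Finite.mem_toFinset _).2 (hs p hp)) fun _ _ _ => abs_nonneg _

/-- The Gaussian hypothesis concerns a limit of partial sums ordered by `ℓ`. Absolute convergence,
from the variation bound, identifies it with the unconditional sum. -/
theorem heatSum_eq_of_tendsto (J : JointData X₁ X₂) {a : ℕ × ℕ → ℝ} {c Q t K : ℝ} (hc : 0 < c)
    (hQ : 0 < Q) (ha : VariationBound (fun p : ℕ × ℕ => J.L p.1 p.2) a c Q) (ht : 0 < t)
    (hK : Tendsto (fun n : ℝ => ∑ᶠ (p : ℕ × ℕ) (_ : J.L p.1 p.2 < n),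
      Real.exp (-(J.L p.1 p.2 ^ 2 * t)) * a p) atTop (𝓝 K)) :
    heatSum (fun p : ℕ × ℕ => J.L p.1 p.2) a t = K := by
  have hsum : Summable fun p : ℕ × ℕ => Real.exp (-(J.L p.1 p.2 ^ 2 * t)) * a p := by
    refine Summable.of_norm ?_
    refine (ha.summable (fun p => J.L_nonneg _ _) hc hQ ht).congr fun p => ?_
    rw [norm_mul, Real.norm_eq_abs, Real.norm_eq_abs, Real.abs_exp, mul_comm]
  have hT : Tendsto (fun n : ℝ => (J.finite_L_lt n).toFinset) atTop atTop := by
    refine tendsto_atTop_finset_of_monotone (fun m n hmn => ?_) fun p =>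
      ⟨J.L p.1 p.2 + 1, (Set.Finite.mem_toFinset _).2 (lt_add_one (J.L p.1 p.2))⟩
    exact Set.Finite.toFinset_subset_toFinset.2 fun p hp => lt_of_lt_of_le hp hmn
  have h1 := hsum.hasSum.comp hT
  have h2 : K = ∑' p : ℕ × ℕ, Real.exp (-(J.L p.1 p.2 ^ 2 * t)) * a p := by
    refine tendsto_nhds_unique hK (h1.congr fun n => ?_)
    have e := finsum_mem_eq_finite_toFinset_sum
      (fun p : ℕ × ℕ => Real.exp (-(J.L p.1 p.2 ^ 2 * t)) * a p) (J.finite_L_lt n)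
    simp only [mem_ofPred_eq] at e
    rw [e]; rfl
  rw [h2, heatSum, Complex.ofReal_tsum]
  congr 1; ext p
  push_cast; ring

/-- Localization covers `n ≥ 1`. For `n₀ ≤ n < 1` only terms with `ℓ < 1` occur, whose total is
bounded by the variation bound, and `n d` is bounded too. This range matters because `n₀` will be
the preservation parameter, possibly below `1`. -/
theorem IsJointDataSpace.exists_kernel_localization {J : JointData X₁ X₂} {Q q₁ q₂ : ℝ}
    (hJ : J.IsJointDataSpace Q q₁ q₂) {h : ℝ → ℝ} (hh : IsLowPassFilter h) (S : ℕ) {n₀ : ℝ}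
    (hn₀ : 0 < n₀) :
    ∃ C : ℝ, 0 < C ∧ ∀ n : ℝ, n₀ ≤ n → ∀ x₁ x₂,
      |J.kernel h n x₁ x₂| * (1 + n * J.d x₁ x₂) ^ S ≤ C * n ^ Q := by
  obtain ⟨c, hc, hvar⟩ := hJ.exists_variationBound
  obtain ⟨c₀, c₁, c₂, hc₀, hc₁, hc₂, hG⟩ := hJ.gaussian
  obtain ⟨D, hD, hdD⟩ := J.exists_d_le
  have hQ := hJ.Q_pos
  obtain ⟨C, hC, H⟩ := VariationBound.exists_localization (l := fun p : ℕ × ℕ => J.L p.1 p.2)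
    (fun p => J.L_nonneg _ _) hh (c₀ := c₀) (c₁ := c₁) hc hQ hc₂ hD S
  have hker : ∀ n x₁ x₂, J.kernel h n x₁ x₂ = ∑' p : ℕ × ℕ, h (J.L p.1 p.2 / n) *
      (J.A p.1 p.2 * J.Ξ₁.phi p.1 x₁ * J.Ξ₂.phi p.2 x₂) := fun n x₁ x₂ => by
    simp only [kernel, mul_assoc]
  refine ⟨C + c * (1 + D) ^ S * (n₀ ^ Q)⁻¹, by positivity, fun n hn x₁ x₂ => ?_⟩
  have hn0 : 0 < n := hn₀.trans_le hn
  have hd0 := J.d_nonneg x₁ x₂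
  rcases le_or_gt 1 n with hn1 | hn1
  · rw [hker]
    refine (H _ (hvar x₁ x₂) (J.d x₁ x₂) hd0 (hdD x₁ x₂) (fun t ht ht1 => ?_) n hn1).trans ?_
    · obtain ⟨K, hK, hKb⟩ := hG x₁ x₂ t ht ht1
      simp only [mul_assoc] at hK
      rw [J.heatSum_eq_of_tendsto hc hQ (hvar x₁ x₂) ht (K := K)
        (by simpa only [mul_assoc] using hK), Complex.norm_real, Real.norm_eq_abs]
      exact hKb
    · rw [add_mul]
      have : 0 ≤ c * (1 + D) ^ S * (n₀ ^ Q)⁻¹ * n ^ Q := by positivity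
      linarith
  · have h1 : |J.kernel h n x₁ x₂| ≤ c := by
      rw [J.kernel_eq_sum hh hn0]
      have h2 := hvar x₁ x₂ 1 one_pos (J.finite_L_lt n).toFinset fun p hp => by
        have := J.mem_toFinset_L_lt.1 hp
        rw [Nat.cast_one]; linarith
      rw [Nat.cast_one, Real.one_rpow, mul_one] at h2
      refine (Finset.abs_sum_le_sum_abs _ _).trans (le_trans (Finset.sum_le_sum fun p _ => ?_) h2)
      rw [mul_assoc, mul_assoc, abs_mul, ← mul_assoc (J.A _ _)]
      refine mul_le_of_le_one_left (abs_nonneg _) ?_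
      have := hh.mem_unit (J.L p.1 p.2 / n)
      rw [abs_of_nonneg this.1]
      exact this.2
    have h2 : n * J.d x₁ x₂ ≤ D := by nlinarith [hdD x₁ x₂]
    calc _ ≤ c * (1 + D) ^ S := by
          gcongr
      _ = c * (1 + D) ^ S * (n₀ ^ Q)⁻¹ * n₀ ^ Q := by
          have : 0 < n₀ ^ Q := by positivity
          field_simp
      _ ≤ (C + c * (1 + D) ^ S * (n₀ ^ Q)⁻¹) * n ^ Q := by
          gcongr
          linarith

/-- A kernel of height `n^Q` integrated over balls of radius `1/n`, of measure at most of order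
`n^(-q₂)`, produces the loss `n^(Q-q₂)`. -/
theorem IsJointDataSpace.exists_sigma_bound {J : JointData X₁ X₂} {Q q₁ q₂ : ℝ}
    (hJ : J.IsJointDataSpace Q q₁ q₂) {h : ℝ → ℝ} (hh : IsLowPassFilter h) {S : ℕ}
    (hS : q₂ < S) {n₀ : ℝ} (hn₀ : 0 < n₀) :
    ∃ C : ℝ, 0 < C ∧ ∀ (n r G : ℝ) (g : C(X₂, ℝ)) (x₁ : X₁), n₀ ≤ n → 0 < r → 0 ≤ G →
      (∀ x₂, J.d x₁ x₂ < r → |g x₂| ≤ G) →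
      |J.sigma h n g x₁| ≤ C * (n ^ (Q - q₂) * G + n ^ (Q - S) * r ^ (q₂ - S) * ‖g‖) := by
  have := J.Ξ₂.isProb
  obtain ⟨c, hc, hreg⟩ := hJ.regularity
  obtain ⟨C₁, hC₁, H₁⟩ := hJ.exists_kernel_localization hh S hn₀
  obtain ⟨C₂, hC₂, H₂⟩ := exists_integral_kernel_bound J.Ξ₂.μ hc hS
  refine ⟨C₂ * C₁, by positivity, fun n r G g x₁ hn hr hG hg => ?_⟩
  have hn0 : 0 < n := hn₀.trans_le hn
  have h1 := H₂ (J.d x₁) (J.continuous_d_right x₁).measurable (J.d_nonneg x₁)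
    (fun ρ hρ => (hreg ρ hρ).2 x₁) n r (C₁ * n ^ Q) G ‖g‖ hn0 hr (by positivity) hG
    (norm_nonneg g) (J.kernel h n x₁) g (H₁ n hn x₁) hg fun y => g.norm_coe_le_norm y
  simp only [sigma, mul_comm (g _)]
  refine h1.trans (le_of_eq ?_)
  rw [sub_eq_add_neg Q q₂, Real.rpow_add hn0, sub_eq_add_neg Q, Real.rpow_add hn0]
  ring

/-- A point of `B` is within `s` of a point of `B⁻`, whose distance to the complement of `A` is at
least `s + r`. The triangle inequality leaves `r`. -/
theorem lt_of_mem_imageSet {J : JointData X₁ X₂} {r s : ℝ} {A : Set X₂} {B : Set X₁}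
    (hB : J.IsImageSet r s A B) {x₁ : X₁} (hx₁ : x₁ ∈ B) {x₂ : X₂}
    (hd : J.d x₁ x₂ < r) : x₂ ∈ A := by
  obtain ⟨Bm, -, hBm, rfl⟩ := hB
  simp only [mem_iUnion, Metric.mem_closedBall, exists_prop] at hx₁
  obtain ⟨y, hy, hxy⟩ := hx₁
  by_contra hx₂
  have h1 : ENNReal.ofReal (s + r) ≤ ENNReal.ofReal (J.d y x₂) :=
    (hBm hy).trans (iInf₂_le x₂ hx₂)
  rw [ENNReal.ofReal_le_ofReal_iff (J.d_nonneg _ _)] at h1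
  have h2 := J.d_triangle_left y x₁ x₂
  rw [dist_comm] at h2
  linarith

end JointData

theorem bddAbove_abs_range {X : Type*} [TopologicalSpace X] [CompactSpace X] (K : Set X)
    (f : C(X, ℝ)) : BddAbove (range fun x : K => |f x|) :=
  ⟨‖f‖, by rintro _ ⟨x, rfl⟩; exact f.norm_coe_le_norm x⟩

theorem abs_le_supNormOn {X : Type*} [TopologicalSpace X] [CompactSpace X] {K : Set X}
    (f : C(X, ℝ)) {x : X} (hx : x ∈ K) : |f x| ≤ supNormOn K f :=
  le_ciSup (bddAbove_abs_range K f) ⟨x, hx⟩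

theorem supNormOn_nonneg {X : Type*} (K : Set X) (f : X → ℝ) : 0 ≤ supNormOn K f :=
  Real.iSup_nonneg fun _ => abs_nonneg _

theorem supNormOn_le {X : Type*} {K : Set X} {f : X → ℝ} {C : ℝ} (hC : 0 ≤ C)
    (h : ∀ x ∈ K, |f x| ≤ C) : supNormOn K f ≤ C :=
  Real.iSup_le (fun x => h x x.2) hC

/-! ### Existence of the lifted function and the error bound -/

namespace JointData

variable {X₁ X₂ : Type*}
  [MetricSpace X₁] [CompactSpace X₁] [MeasurableSpace X₁] [BorelSpace X₁]
  [MetricSpace X₂] [CompactSpace X₂] [MeasurableSpace X₂] [BorelSpace X₂]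

theorem dyadicTerm_eq (J : JointData X₁ X₂) {h : ℝ → ℝ} (hh : IsLowPassFilter h) (Q q₂ : ℝ)
    (A : Set X₂) (f : C(X₂, ℝ)) (m : ℕ) :
    J.dyadicTerm h Q q₂ A f m = (2 : ℝ) ^ ((m : ℝ) * (Q - q₂)) *
      supNormOn A (J.Ξ₂.sigmaC h (2 ^ (m + 1)) f - J.Ξ₂.sigmaC h (2 ^ m) f : C(X₂, ℝ)) := by
  rw [dyadicTerm]
  congr 2
  ext x
  rw [ContinuousMap.sub_apply, J.Ξ₂.sigmaC_apply hh (by positivity),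
    J.Ξ₂.sigmaC_apply hh (by positivity)]

theorem dyadicTerm_nonneg (J : JointData X₁ X₂) (h : ℝ → ℝ) (Q q₂ : ℝ)
    (A : Set X₂) (f : C(X₂, ℝ)) (m : ℕ) : 0 ≤ J.dyadicTerm h Q q₂ A f m :=
  mul_nonneg (by positivity) (supNormOn_nonneg _ _)

theorem PolynomialPreservation.sigma_sigmaC {J : JointData X₁ X₂} {h : ℝ → ℝ} {c : ℝ}
    (hc : J.PolynomialPreservation h c) (f : C(X₂, ℝ)) {m : ℕ} {N : ℝ} (hN : c * 2 ^ m ≤ N)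
    (x : X₁) : J.sigma h N (J.Ξ₂.sigmaC h (2 ^ m) f) x =
      J.sigma h (c * 2 ^ m) (J.Ξ₂.sigmaC h (2 ^ m) f) x := by
  have := hc.2 (2 ^ m) (by positivity) (J.Ξ₂.sigmaC h (2 ^ m) f)
    (by push_cast; exact J.Ξ₂.sigmaC_mem h _ f) N (by push_cast; exact hN)
  rw [this]
  push_cast
  rfl

/-- Both endpoint powers `c^e` and `(2c)^e` appear so that either sign of `e` is covered. -/
theorem rpow_le_of_dyadic {c N : ℝ} (hc : 0 < c) {m : ℕ} (h1 : c * 2 ^ m ≤ N)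
    (h2 : N ≤ c * 2 ^ (m + 1)) (e : ℝ) :
    N ^ e ≤ (c ^ e + (2 * c) ^ e) * 2 ^ ((m : ℝ) * e) := by
  have hm : (0 : ℝ) < 2 ^ m := by positivity
  have hN : 0 < N := lt_of_lt_of_le (by positivity) h1
  have hu1 : c ≤ N / 2 ^ m := by rwa [le_div_iff₀ hm]
  have hu2 : N / 2 ^ m ≤ 2 * c := by rw [div_le_iff₀ hm]; rw [pow_succ] at h2; linarith
  have h3 : (N / 2 ^ m) ^ e ≤ c ^ e + (2 * c) ^ e := by
    have p1 : 0 < c ^ e := by positivity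
    have p2 : 0 < (2 * c) ^ e := by positivity
    rcases le_total 0 e with he | he
    · have := Real.rpow_le_rpow (by positivity) hu2 he
      linarith
    · have := Real.rpow_le_rpow_of_nonpos hc hu1 he
      linarith
  have h4 : N ^ e = (N / 2 ^ m) ^ e * 2 ^ ((m : ℝ) * e) := by
    rw [Real.rpow_mul two_pos.le, Real.rpow_natCast, ← Real.mul_rpow (by positivity) hm.le,
      div_mul_cancel₀ _ hm.ne']
  rw [h4]
  gcongr

theorem IsJointDataSpace.exists_sigma_dyadic_bound {J : JointData X₁ X₂} {Q q₁ q₂ : ℝ}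
    (hJ : J.IsJointDataSpace Q q₁ q₂) {h : ℝ → ℝ} (hh : IsLowPassFilter h) {S : ℕ}
    (hS : q₂ < S) {c : ℝ} (hc : 0 < c) :
    ∃ C : ℝ, 0 < C ∧ ∀ (r s : ℝ) (A : Set X₂) (B : Set X₁), 0 < r → J.IsImageSet r s A B →
      ∀ (g : C(X₂, ℝ)) (m : ℕ) (N : ℝ), c * 2 ^ m ≤ N → N ≤ c * 2 ^ (m + 1) → ∀ x ∈ B,
        |J.sigma h N g x| ≤ C * ((2 : ℝ) ^ ((m : ℝ) * (Q - q₂)) * supNormOn A g +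
          (2 : ℝ) ^ ((m : ℝ) * (Q - S)) * r ^ (q₂ - S) * ‖g‖) := by
  obtain ⟨C, hC, H⟩ := hJ.exists_sigma_bound hh hS hc
  set K₁ := c ^ (Q - q₂) + (2 * c) ^ (Q - q₂) with hK₁
  set K₂ := c ^ (Q - S) + (2 * c) ^ (Q - S) with hK₂
  have hK₁0 : 0 < K₁ := by positivity
  have hK₂0 : 0 < K₂ := by positivity
  refine ⟨C * (K₁ + K₂), by positivity, fun r s A B hr hB g m N h1 h2 x hx => ?_⟩
  have hcN : c ≤ N := le_trans (le_mul_of_one_le_right hc.le (one_le_pow₀ one_le_two)) h1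
  have h3 := H N r (supNormOn A g) g x hcN hr (supNormOn_nonneg _ _)
    fun y hy => abs_le_supNormOn g (lt_of_mem_imageSet hB hx hy)
  refine h3.trans ?_
  have hg0 := supNormOn_nonneg A g
  calc _ ≤ C * ((K₁ * 2 ^ ((m : ℝ) * (Q - q₂))) * supNormOn A g +
        (K₂ * 2 ^ ((m : ℝ) * (Q - S))) * r ^ (q₂ - S) * ‖g‖) := by
        gcongr
        · exact rpow_le_of_dyadic hc h1 h2 _
        · exact rpow_le_of_dyadic hc h1 h2 _
    _ ≤ C * (((K₁ + K₂) * 2 ^ ((m : ℝ) * (Q - q₂))) * supNormOn A g +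
        ((K₁ + K₂) * 2 ^ ((m : ℝ) * (Q - S))) * r ^ (q₂ - S) * ‖g‖) := by
        gcongr <;> linarith
    _ = _ := by ring

/-- If `Q < q₂`, the weight decays and the errors are bounded. If `Q ≥ q₂`, the weight is
non-decreasing in `m`. Since `P_j → f`, telescoping then bounds the weighted error by a tail of the
convergent series. -/
theorem tendsto_dyadic_error (J : JointData X₁ X₂) {h : ℝ → ℝ} (hh : IsLowPassFilter h)
    (hpu : J.Ξ₂.HasPartitionOfUnity) {Q q₂ : ℝ} {A : Set X₂} {f : C(X₂, ℝ)}
    (hf : Summable (J.dyadicTerm h Q q₂ A f)) :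
    Tendsto (fun m : ℕ => (2 : ℝ) ^ ((m : ℝ) * (Q - q₂)) *
      supNormOn A (f - J.Ξ₂.sigmaC h (2 ^ m) f : C(X₂, ℝ))) atTop (𝓝 0) := by
  rcases lt_or_ge Q q₂ with hQ | hQ
  · obtain ⟨C, hC, H⟩ := J.Ξ₂.exists_norm_sigmaC_le hh
    have h1 : Tendsto (fun m : ℕ => ((2 : ℝ) ^ (Q - q₂)) ^ m * ((1 + C) * ‖f‖)) atTop (𝓝 0) := by
      have := (tendsto_pow_atTop_nhds_zero_of_lt_one (r := (2 : ℝ) ^ (Q - q₂)) (by positivity)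
        (Real.rpow_lt_one_of_one_lt_of_neg one_lt_two (by linarith))).mul_const ((1 + C) * ‖f‖)
      simpa using this
    refine squeeze_zero (fun m => mul_nonneg (by positivity) (supNormOn_nonneg _ _)) (fun m => ?_) h1
    rw [mul_comm (m : ℝ), Real.rpow_mul two_pos.le, Real.rpow_natCast]
    gcongr
    refine supNormOn_le (by positivity) fun x _ => ?_
    refine ((f - J.Ξ₂.sigmaC h (2 ^ m) f).norm_coe_le_norm x).trans ((norm_sub_le _ _).trans ?_)
    have := H (2 ^ m) (one_le_pow₀ one_le_two) f
    linarith
  · have htail := tendsto_sum_nat_add (J.dyadicTerm h Q q₂ A f)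
    refine squeeze_zero (fun m => mul_nonneg (by positivity) (supNormOn_nonneg _ _)) (fun m => ?_)
      htail
    have hsm : Summable fun k => J.dyadicTerm h Q q₂ A f (k + m) := (summable_nat_add_iff m).2 hf
    have hp : (0 : ℝ) < 2 ^ ((m : ℝ) * (Q - q₂)) := by positivity
    have hT0 : 0 ≤ ∑' k, J.dyadicTerm h Q q₂ A f (k + m) :=
      tsum_nonneg fun k => J.dyadicTerm_nonneg h Q q₂ A f _
    rw [← le_div_iff₀' hp]
    refine supNormOn_le (by positivity) fun x hx => ?_
    rw [le_div_iff₀' hp]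
    have hpart : ∀ j : ℕ, (2 : ℝ) ^ ((m : ℝ) * (Q - q₂)) *
        |J.Ξ₂.sigmaC h (2 ^ (j + m)) f x - J.Ξ₂.sigmaC h (2 ^ m) f x| ≤
        ∑ k ∈ Finset.range j, J.dyadicTerm h Q q₂ A f (k + m) := by
      intro j
      induction j with
      | zero => simp
      | succ j ih =>
        rw [Finset.sum_range_succ]
        have h1 : (2 : ℝ) ^ ((m : ℝ) * (Q - q₂)) *
            |J.Ξ₂.sigmaC h (2 ^ (j + 1 + m)) f x - J.Ξ₂.sigmaC h (2 ^ (j + m)) f x| ≤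
            J.dyadicTerm h Q q₂ A f (j + m) := by
          rw [J.dyadicTerm_eq hh]
          have h2 : (2 : ℝ) ^ ((m : ℝ) * (Q - q₂)) ≤ 2 ^ (((j + m : ℕ) : ℝ) * (Q - q₂)) := by
            apply Real.rpow_le_rpow_of_exponent_le one_le_two
            push_cast
            have : 0 ≤ (j : ℝ) * (Q - q₂) := mul_nonneg (Nat.cast_nonneg _) (by linarith)
            linarith
          have h3 := abs_le_supNormOn (J.Ξ₂.sigmaC h (2 ^ (j + m + 1)) f -
            J.Ξ₂.sigmaC h (2 ^ (j + m)) f) hx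
          rw [ContinuousMap.sub_apply] at h3
          rw [show j + 1 + m = j + m + 1 by ring]
          gcongr
        have h4 := abs_sub_le (J.Ξ₂.sigmaC h (2 ^ (j + 1 + m)) f x)
          (J.Ξ₂.sigmaC h (2 ^ (j + m)) f x) (J.Ξ₂.sigmaC h (2 ^ m) f x)
        calc _ ≤ (2 : ℝ) ^ ((m : ℝ) * (Q - q₂)) *
              (|J.Ξ₂.sigmaC h (2 ^ (j + 1 + m)) f x - J.Ξ₂.sigmaC h (2 ^ (j + m)) f x| +
                |J.Ξ₂.sigmaC h (2 ^ (j + m)) f x - J.Ξ₂.sigmaC h (2 ^ m) f x|) := by gcongr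
          _ ≤ _ := by rw [mul_add]; linarith
    have hlim : Tendsto (fun j : ℕ => J.Ξ₂.sigmaC h (2 ^ (j + m)) f x) atTop (𝓝 (f x)) := by
      have e1 : Tendsto (fun j : ℕ => (2 : ℝ) ^ (j + m)) atTop atTop :=
        (tendsto_pow_atTop_atTop_of_one_lt one_lt_two).comp (tendsto_add_atTop_nat m)
      have e2 := (hpu.tendsto_sigmaC hh f).comp e1
      exact ((continuous_eval_const x).tendsto f).comp e2
    refine le_of_tendsto ((hlim.sub_const _).abs.const_mul _) (Eventually.of_forall fun j => ?_)
    exact (hpart j).trans (hsm.sum_le_tsum _ fun k _ => J.dyadicTerm_nonneg h Q q₂ A f _)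

/-- Existence of the lifted function on an image set, and the error bound for `σ_{c 2 ^ n}`. -/
theorem IsJointDataSpace.exists_lift_bound {J : JointData X₁ X₂} {Q q₁ q₂ : ℝ}
    (hJ : J.IsJointDataSpace Q q₁ q₂) {h : ℝ → ℝ} (hh : IsLowPassFilter h) {S : ℕ}
    (hS : q₂ < S) (hQS : Q < S) {c : ℝ} (hc : J.PolynomialPreservation h c)
    (hpu : J.Ξ₂.HasPartitionOfUnity) :
    ∃ C : ℝ, 0 < C ∧ ∀ (r s : ℝ) (A : Set X₂) (B : Set X₁), 0 < r → J.IsImageSet r s A B →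
      ∀ f : C(X₂, ℝ), Summable (J.dyadicTerm h Q q₂ A f) →
        TendstoUniformlyOn (fun n : ℝ => J.sigma h n f) (J.lift h f) atTop B ∧
        ∀ n : ℕ, ∀ x ∈ B, |J.lift h f x - J.sigma h (c * 2 ^ n) f x| ≤
            C * ((2 : ℝ) ^ ((n : ℝ) * (Q - q₂)) *
                  supNormOn A (f - J.Ξ₂.sigmaC h (2 ^ n) f : C(X₂, ℝ))
                + ‖f‖ * (2 : ℝ) ^ ((n : ℝ) * (Q - S)) * r ^ (q₂ - S)
                + ∑' m : ℕ, J.dyadicTerm h Q q₂ A f (n + m)) := by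
  have hc0 := hc.1
  obtain ⟨C₁, hC₁, H₁⟩ := hJ.exists_sigma_dyadic_bound hh hS hc0
  obtain ⟨C₂, hC₂, H₂⟩ := J.Ξ₂.exists_norm_sigmaC_le hh
  set ρ : ℝ := 2 ^ (Q - S) with hρ
  have hρ0 : 0 < ρ := by positivity
  have hρ1 : ρ < 1 := Real.rpow_lt_one_of_one_lt_of_neg one_lt_two (by linarith)
  have hρ1' : 0 < 1 - ρ := by linarith
  have hρm : ∀ m : ℕ, (2 : ℝ) ^ ((m : ℝ) * (Q - S)) = ρ ^ m := fun m => by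
    rw [mul_comm, Real.rpow_mul two_pos.le, Real.rpow_natCast]
  -- `1` serves the two terms measured on `A`. The factor `1 + C₂` comes from `‖f - P_n‖`, and
  -- `2C₂/(1 - ρ)` from summing the global parts of `P_{m+1} - P_m`.
  refine ⟨C₁ * (1 + (1 + C₂) + 2 * C₂ * (1 - ρ)⁻¹), by positivity,
    fun r s A B hr hB f hf => ?_⟩
  set P : ℕ → C(X₂, ℝ) := fun m => J.Ξ₂.sigmaC h (2 ^ m) f with hP
  have hPn : ∀ m, ‖P m‖ ≤ C₂ * ‖f‖ := fun m => H₂ _ (one_le_pow₀ one_le_two) f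
  set R := r ^ (q₂ - S) * ‖f‖ with hR
  have hR0 : 0 ≤ R := by positivity
  set v : ℕ → X₁ → ℝ := fun m x => J.sigma h (c * 2 ^ m) (P m) x with hv
  set t := J.dyadicTerm h Q q₂ A f with ht
  have ht0 : ∀ m, 0 ≤ t m := J.dyadicTerm_nonneg h Q q₂ A f
  set b : ℕ → ℝ := fun m => C₁ * (t m + 2 * C₂ * R * ρ ^ m) with hb
  have hgeo := summable_geometric_of_lt_one hρ0.le hρ1
  have hbs : Summable b := (hf.add (hgeo.mul_left _)).mul_left _
  have hpos : ∀ m : ℕ, 0 < c * 2 ^ m := fun m => by positivity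
  have hmono : ∀ m : ℕ, c * 2 ^ m ≤ c * 2 ^ (m + 1) := fun m => by
    gcongr
    · exact one_le_two
    · exact Nat.le_succ m
  have hstep : ∀ m, ∀ x ∈ B, dist (v m x) (v m.succ x) ≤ b m := by
    intro m x hx
    have e1 : v m.succ x - v m x = J.sigma h (c * 2 ^ (m + 1)) (P (m + 1) - P m) x := by
      rw [J.sigma_sub hh (hpos _), hc.sigma_sigmaC f (hmono m)]
    rw [dist_comm, Real.dist_eq, e1]
    refine (H₁ r s A B hr hB (P (m + 1) - P m) m _ (hmono m) le_rfl x hx).trans ?_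
    rw [hb, hρm]
    simp only
    rw [ht, J.dyadicTerm_eq hh]
    gcongr C₁ * (_ + ?_)
    have e2 : ‖P (m + 1) - P m‖ ≤ 2 * C₂ * ‖f‖ := by
      refine (norm_sub_le _ _).trans ?_
      have := hPn m
      have := hPn (m + 1)
      linarith
    calc _ ≤ ρ ^ m * r ^ (q₂ - S) * (2 * C₂ * ‖f‖) := by gcongr
      _ = _ := by rw [hR]; ring
  set e : ℕ → ℝ := fun m => C₁ * ((2 : ℝ) ^ ((m : ℝ) * (Q - q₂)) * supNormOn A (f - P m : C(X₂, ℝ))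
    + (1 + C₂) * R * ρ ^ m) with he
  have herr : ∀ (m : ℕ) (N : ℝ), c * 2 ^ m ≤ N → N ≤ c * 2 ^ (m + 1) → ∀ x ∈ B,
      |J.sigma h N f x - v m x| ≤ e m := by
    intro m N h1 h2 x hx
    have e1 : J.sigma h N f x - v m x = J.sigma h N (f - P m) x := by
      rw [J.sigma_sub hh ((hpos m).trans_le h1), hc.sigma_sigmaC f h1]
    rw [e1]
    refine (H₁ r s A B hr hB (f - P m) m N h1 h2 x hx).trans ?_
    rw [he, hρm]
    simp only
    gcongr C₁ * (_ + ?_)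
    have e2 : ‖f - P m‖ ≤ (1 + C₂) * ‖f‖ := by
      refine (norm_sub_le _ _).trans ?_
      have := hPn m
      linarith
    calc _ ≤ ρ ^ m * r ^ (q₂ - S) * ((1 + C₂) * ‖f‖) := by gcongr
      _ = _ := by rw [hR]; ring
  -- The limit is first taken pointwise along the `v m`. The bounds `b` and `e` do not depend on
  -- `x`, which later makes the convergence uniform on `B`. The value off `B` is immaterial.
  have hconv : ∀ x, ∃ y, x ∈ B → Tendsto (fun m => v m x) atTop (𝓝 y) := fun x => by
    by_cases hx : x ∈ B
    · obtain ⟨y, hy⟩ := cauchySeq_tendsto_of_complete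
        (cauchySeq_of_dist_le_of_summable b (fun m => hstep m x hx) hbs)
      exact ⟨y, fun _ => hy⟩
    · exact ⟨0, fun h' => absurd h' hx⟩
  choose y hy using hconv
  have htail : ∀ m, ∀ x ∈ B, |v m x - y x| ≤ ∑' k, b (m + k) := fun m x hx =>
    dist_le_tsum_of_dist_le_of_tendsto b (fun m => hstep m x hx) hbs (hy x hx) m
  have hb_tail : Tendsto (fun m => ∑' k, b (m + k)) atTop (𝓝 0) := by
    simpa only [add_comm] using tendsto_sum_nat_add b
  have he0 : Tendsto e atTop (𝓝 0) := by
    have e1 := J.tendsto_dyadic_error hh hpu hf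
    have e2 := (tendsto_pow_atTop_nhds_zero_of_lt_one hρ0.le hρ1).const_mul ((1 + C₂) * R)
    have e3 := (e1.add e2).const_mul C₁
    rw [mul_zero, add_zero, mul_zero] at e3
    exact e3
  have hunif : TendstoUniformlyOn (fun n : ℝ => J.sigma h n f) y atTop B := by
    rw [Metric.tendstoUniformlyOn_iff]
    intro ε hε
    have h1 : Tendsto (fun m => e m + ∑' k, b (m + k)) atTop (𝓝 0) := by
      simpa using he0.add hb_tail
    obtain ⟨M, hM⟩ := (h1.eventually (gt_mem_nhds hε)).exists_forall_of_atTop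
    filter_upwards [eventually_ge_atTop (c * 2 ^ M)] with N hN x hx
    have hN1 : 1 ≤ N / c := by
      rw [one_le_div hc0]
      exact le_trans (le_mul_of_one_le_right hc0.le (one_le_pow₀ one_le_two)) hN
    -- The real parameter `N` is trapped in `c2^m ≤ N < c2^(m+1)`, where `σ_N f` is compared with `v
    -- m`.
    obtain ⟨m, hm1, hm2⟩ := exists_nat_pow_near hN1 (one_lt_two (α := ℝ))
    have hMm : M ≤ m := by
      have : (2 : ℝ) ^ M < 2 ^ (m + 1) := lt_of_le_of_lt (by rwa [le_div_iff₀' hc0]) hm2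
      have := (pow_lt_pow_iff_right₀ (one_lt_two (α := ℝ))).1 this
      omega
    rw [le_div_iff₀' hc0] at hm1
    rw [div_lt_iff₀' hc0] at hm2
    rw [dist_comm, Real.dist_eq]
    calc _ ≤ |J.sigma h N f x - v m x| + |v m x - y x| := abs_sub_le _ _ _
      _ ≤ e m + ∑' k, b (m + k) := add_le_add (herr m N hm1 hm2.le x hx) (htail m x hx)
      _ < ε := hM m hMm
  have hlift : ∀ x ∈ B, J.lift h f x = y x := fun x hx => (hunif.tendsto_at hx).limUnder_eq
  refine ⟨hunif.congr_right fun x hx => (hlift x hx).symm, fun n x hx => ?_⟩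
  have h1 := htail n x hx
  have h2 := herr n (c * 2 ^ n) le_rfl (hmono n) x hx
  have h3 : ∑' k, b (n + k) = C₁ * (∑' m, t (n + m) + 2 * C₂ * R * ρ ^ n * (1 - ρ)⁻¹) := by
    have s1 : Summable fun m => t (n + m) := by
      simpa only [add_comm] using (summable_nat_add_iff n).2 hf
    simp only [hb, tsum_mul_left, pow_add, ← mul_assoc]
    rw [Summable.tsum_add s1 (hgeo.mul_left _), tsum_mul_left, tsum_geometric_of_lt_one hρ0.le hρ1]
  have hT0 : 0 ≤ ∑' m, t (n + m) := tsum_nonneg fun m => ht0 _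
  have hA0 := supNormOn_nonneg A (f - P n : C(X₂, ℝ))
  rw [hlift x hx, hρm]
  set a := (2 : ℝ) ^ ((n : ℝ) * (Q - q₂)) * supNormOn A (f - P n : C(X₂, ℝ)) with ha
  have ha0 : 0 ≤ a := by positivity
  have hw0 : 0 ≤ R * ρ ^ n := by positivity
  calc |y x - J.sigma h (c * 2 ^ n) f x|
      ≤ |v n x - y x| + |J.sigma h (c * 2 ^ n) f x - v n x| := by
        rw [abs_sub_comm, add_comm]
        exact abs_sub_le _ _ _
    _ ≤ C₁ * (∑' m, t (n + m) + 2 * C₂ * R * ρ ^ n * (1 - ρ)⁻¹) +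
        C₁ * (a + (1 + C₂) * R * ρ ^ n) := by rw [← h3]; exact add_le_add h1 h2
    _ = C₁ * (1 * a + ((1 + C₂) + 2 * C₂ * (1 - ρ)⁻¹) * (R * ρ ^ n) + 1 * ∑' m, t (n + m)) := by
        ring
    _ ≤ C₁ * ((1 + (1 + C₂) + 2 * C₂ * (1 - ρ)⁻¹) * a +
        (1 + (1 + C₂) + 2 * C₂ * (1 - ρ)⁻¹) * (R * ρ ^ n) +
        (1 + (1 + C₂) + 2 * C₂ * (1 - ρ)⁻¹) * ∑' m, t (n + m)) := by
        have p : 0 < (1 - ρ)⁻¹ := by positivity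
        have p' : 0 < 2 * C₂ * (1 - ρ)⁻¹ := by positivity
        gcongr <;> linarith
    _ = _ := by rw [hR]; ring

end JointData

/-! ### Smoothness of the lifted function -/

/-- Replace `φ` in `φ F_m` by some `P ∈ Π_{K2^m}`. The product `P F_m` lies in `Π_{aK2^m}`, and
approximating `φ` at rate `β + η` compensates the growth `2^(mη)` of `F_m`. -/
theorem DataSpace.StrongProduct.mem_W_of_approx {X : Type*} [MetricSpace X] [CompactSpace X]
    [MeasurableSpace X] [BorelSpace X] {D : DataSpace X} (hD : D.StrongProduct) {φ g : C(X, ℝ)}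
    (hφ : φ ∈ D.smooth) {F : ℕ → C(X, ℝ)} {K : ℕ} (hK : 0 < K) {β η M : ℝ} (hβ : 0 < β)
    (hη : 0 < η) (hF : ∀ m : ℕ, F m ∈ D.diffPoly (K * 2 ^ m))
    (hFM : ∀ m : ℕ, ‖F m‖ ≤ M * (2 ^ m : ℝ) ^ η)
    (hg : ∀ m : ℕ, ‖g - φ * F m‖ ≤ M * (2 ^ m : ℝ) ^ (-β)) : g ∈ D.W β := by
  obtain ⟨a, ha, hprod⟩ := hD
  obtain ⟨C, hC⟩ := D.mem_W_iff.1 (hφ (β + η) (by positivity))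
  have hC0 : 0 ≤ C := le_trans (mul_nonneg (by positivity) (D.degApprox_nonneg 1 φ)) (hC 1 one_pos)
  have hM0 : 0 ≤ M := by
    have := (norm_nonneg _).trans (hg 0)
    simpa using this
  have ha0 : 0 < a := by linarith
  have hK1 : (1 : ℝ) ≤ K := by exact_mod_cast hK
  have hK0 : (0 : ℝ) < K := by linarith
  set M' := M + (C + 1) * M with hM'
  have happ : ∀ m : ℕ, D.degApprox (a * (K * 2 ^ m)) g ≤ M' * (2 ^ m : ℝ) ^ (-β) := by
    intro m
    set u : ℝ := 2 ^ m with hu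
    have hu0 : 0 < u := by positivity
    have h1 := hC (K * u) (by positivity)
    -- The constant `C + 1` makes the inequality strict, so that an actual `P` can be taken from the
    -- infimum.
    have h2 : D.degApprox (K * u) φ < (C + 1) * u ^ (-(β + η)) := by
      rw [Real.rpow_neg hu0.le, ← div_eq_mul_inv, lt_div_iff₀' (by positivity)]
      have h3 : u ^ (β + η) ≤ (K * u) ^ (β + η) :=
        Real.rpow_le_rpow hu0.le (le_mul_of_one_le_left hu0.le hK1) (by positivity)
      have := mul_le_mul_of_nonneg_right h3 (D.degApprox_nonneg (K * u) φ)
      linarith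
    obtain ⟨P, hP, hPφ⟩ := D.exists_mem_diffPoly_lt h2
    have hPF : P * F m ∈ D.diffPoly (a * (K * u)) := by
      have := hprod (K * 2 ^ m) (by positivity) P (by push_cast; exact hP) (F m)
        (by push_cast; exact hF m)
      push_cast at this
      exact this
    have e : u ^ (-(β + η)) * u ^ η = u ^ (-β) := by
      rw [← Real.rpow_add hu0]; congr 1; ring
    calc _ ≤ ‖g - P * F m‖ := D.degApprox_le hPF
      _ = ‖(g - φ * F m) + (φ - P) * F m‖ := by congr 1; ring
      _ ≤ ‖g - φ * F m‖ + ‖φ - P‖ * ‖F m‖ := (norm_add_le _ _).trans (by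
          gcongr; exact norm_mul_le _ _)
      _ ≤ M * u ^ (-β) + (C + 1) * u ^ (-(β + η)) * (M * u ^ η) := by
          gcongr
          · exact hg m
          · exact hFM m
      _ = M * u ^ (-β) + (C + 1) * M * (u ^ (-(β + η)) * u ^ η) := by ring
      _ = _ := by rw [e, hM']; ring
  have haK : 0 < a * K := by positivity
  refine D.mem_W_iff.2 ⟨(a * K) ^ β * ‖g‖ + (2 * (a * K)) ^ β * M', fun n hn => ?_⟩
  have hM'0 : 0 ≤ M' := by positivity
  have p1 : 0 ≤ (a * K) ^ β * ‖g‖ := by positivity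
  have p2 : 0 ≤ (2 * (a * K)) ^ β * M' := by positivity
  -- Below `aK`, the order reached at `m = 0`, approximation by `0` suffices.
  rcases lt_or_ge n (a * K) with hnK | hnK
  · have h1 : D.degApprox n g ≤ ‖g‖ := by
      simpa using D.degApprox_le (f := g) (Submodule.zero_mem (D.diffPoly n))
    have h2 : n ^ β ≤ (a * K) ^ β := Real.rpow_le_rpow hn.le hnK.le hβ.le
    have := mul_le_mul h2 h1 (D.degApprox_nonneg n g) (by positivity)
    linarith
  · obtain ⟨m, hm1, hm2⟩ := exists_nat_pow_near ((one_le_div haK).2 hnK) (one_lt_two (α := ℝ))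
    rw [le_div_iff₀ haK] at hm1
    rw [div_lt_iff₀ haK] at hm2
    have h1 : D.degApprox n g ≤ D.degApprox (a * (K * 2 ^ m)) g :=
      Metric.infDist_le_infDist_of_subset (D.diffPoly_mono (by linarith))
        ⟨0, Submodule.zero_mem _⟩
    have hu0 : (0 : ℝ) < 2 ^ m := by positivity
    have h2 : n ^ β ≤ (2 * (a * K)) ^ β * (2 ^ m : ℝ) ^ β := by
      rw [← Real.mul_rpow (by positivity) hu0.le]
      refine Real.rpow_le_rpow hn.le ?_ hβ.le
      rw [pow_succ] at hm2
      linarith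
    have h3 : (2 ^ m : ℝ) ^ β * (2 ^ m : ℝ) ^ (-β) = 1 := by rw [← Real.rpow_add hu0]; simp
    calc _ ≤ ((2 * (a * K)) ^ β * (2 ^ m : ℝ) ^ β) * (M' * (2 ^ m : ℝ) ^ (-β)) :=
          mul_le_mul h2 (h1.trans (happ m)) (D.degApprox_nonneg n g) (by positivity)
      _ = (2 * (a * K)) ^ β * M' * ((2 ^ m : ℝ) ^ β * (2 ^ m : ℝ) ^ (-β)) := by ring
      _ ≤ _ := by rw [h3]; linarith

namespace JointData

variable {X₁ X₂ : Type*}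
  [MetricSpace X₁] [CompactSpace X₁] [MeasurableSpace X₁] [BorelSpace X₁]
  [MetricSpace X₂] [CompactSpace X₂] [MeasurableSpace X₂] [BorelSpace X₂]

/-- For locally smooth `f`, the error of approximation of the lifted function decays with the rate
given by the loss of smoothness `Q - q₂`. -/
theorem exists_lift_error_rate (J : JointData X₁ X₂) {h : ℝ → ℝ} (hh : IsLowPassFilter h)
    (hpu : J.Ξ₂.HasPartitionOfUnity) {Q q₂ C R γ c : ℝ} {S : ℕ} (hC : 0 < C) (hR : 0 ≤ R)
    (hγ : 0 < γ)
    (hγ₁ : Q - q₂ < γ) (hγ₂ : γ < S - q₂) {A : Set X₂} {B : Set X₁}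
    (hA : IsCompact A) {f : C(X₂, ℝ)} (hf : f ∈ J.Ξ₂.WOn γ A)
    (hb : ∀ n : ℕ, ∀ x ∈ B, |J.lift h f x - J.sigma h (c * 2 ^ n) f x| ≤
      C * ((2 : ℝ) ^ ((n : ℝ) * (Q - q₂)) *
        supNormOn A (f - J.Ξ₂.sigmaC h (2 ^ n) f : C(X₂, ℝ))
        + ‖f‖ * (2 : ℝ) ^ ((n : ℝ) * (Q - S)) * R
        + ∑' m : ℕ, J.dyadicTerm h Q q₂ A f (n + m))) :
    ∃ M : ℝ, 0 ≤ M ∧ ∀ n : ℕ, ∀ x ∈ B,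
      |J.lift h f x - J.sigma h (c * 2 ^ n) f x| ≤ M * (2 ^ n : ℝ) ^ (-(γ - Q + q₂)) := by
  obtain ⟨Cw, hCw, Hw⟩ := hpu.exists_abs_sub_sigmaC_le_of_mem_WOn hh hA hf
  set β := γ - Q + q₂ with hβ
  have hβ0 : 0 < β := by linarith
  set ρ : ℝ := 2 ^ (-β) with hρ
  have hρ0 : 0 < ρ := by positivity
  have hρ1 : ρ < 1 := Real.rpow_lt_one_of_one_lt_of_neg one_lt_two (by linarith)
  have hρn : ∀ n : ℕ, (2 ^ n : ℝ) ^ (-β) = ρ ^ n := fun n => by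
    rw [← Real.rpow_natCast, ← Real.rpow_mul two_pos.le, mul_comm, Real.rpow_mul two_pos.le,
      Real.rpow_natCast]
  have hsup : ∀ n : ℕ, supNormOn A (f - J.Ξ₂.sigmaC h (2 ^ n) f : C(X₂, ℝ)) ≤
      Cw * (2 ^ n : ℝ) ^ (-γ) := fun n =>
    supNormOn_le (by positivity) fun x hx => Hw _ (one_le_pow₀ one_le_two) x hx
  have hexp : ∀ n : ℕ, (2 : ℝ) ^ ((n : ℝ) * (Q - q₂)) * (2 ^ n : ℝ) ^ (-γ) = ρ ^ n := fun n => by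
    rw [← hρn, ← Real.rpow_natCast, ← Real.rpow_mul two_pos.le, ← Real.rpow_mul two_pos.le,
      ← Real.rpow_add two_pos]
    congr 1
    rw [hβ]; ring
  have hterm : ∀ n : ℕ, J.dyadicTerm h Q q₂ A f n ≤ 2 * Cw * ρ ^ n := by
    intro n
    rw [J.dyadicTerm_eq hh]
    have h1 : supNormOn A (J.Ξ₂.sigmaC h (2 ^ (n + 1)) f - J.Ξ₂.sigmaC h (2 ^ n) f : C(X₂, ℝ)) ≤
        2 * Cw * (2 ^ n : ℝ) ^ (-γ) := by
      refine supNormOn_le (by positivity) fun x hx => ?_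
      have a1 := Hw (2 ^ n) (one_le_pow₀ one_le_two) x hx
      have a2 := Hw (2 ^ (n + 1)) (one_le_pow₀ one_le_two) x hx
      have a3 : (2 ^ (n + 1) : ℝ) ^ (-γ) ≤ (2 ^ n : ℝ) ^ (-γ) :=
        Real.rpow_le_rpow_of_nonpos (by positivity)
          (pow_le_pow_right₀ one_le_two (Nat.le_succ n)) (by linarith)
      have a4 := mul_le_mul_of_nonneg_left a3 hCw
      have a5 := abs_sub_le (J.Ξ₂.sigmaC h (2 ^ (n + 1)) f x) (f x) (J.Ξ₂.sigmaC h (2 ^ n) f x)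
      rw [abs_sub_comm _ (f x)] at a5
      rw [ContinuousMap.sub_apply]
      linarith
    calc _ ≤ (2 : ℝ) ^ ((n : ℝ) * (Q - q₂)) * (2 * Cw * (2 ^ n : ℝ) ^ (-γ)) := by gcongr
      _ = _ := by rw [mul_left_comm, hexp]
  refine ⟨C * (Cw + ‖f‖ * R + 2 * Cw * (1 - ρ)⁻¹), ?_, fun n x hx => ?_⟩
  · have : 0 < (1 - ρ)⁻¹ := inv_pos.2 (by linarith)
    positivity
  have h1 : (2 : ℝ) ^ ((n : ℝ) * (Q - q₂)) *
      supNormOn A (f - J.Ξ₂.sigmaC h (2 ^ n) f : C(X₂, ℝ)) ≤ Cw * ρ ^ n := by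
    calc _ ≤ (2 : ℝ) ^ ((n : ℝ) * (Q - q₂)) * (Cw * (2 ^ n : ℝ) ^ (-γ)) := by
          gcongr; exact hsup n
      _ = _ := by rw [mul_left_comm, hexp]
  -- This is where `γ < S - q₂` enters: the localization error must not exceed the rate `2^(-nβ)`.
  have h2 : (2 : ℝ) ^ ((n : ℝ) * (Q - S)) ≤ ρ ^ n := by
    rw [← hρn, ← Real.rpow_natCast, ← Real.rpow_mul two_pos.le]
    refine Real.rpow_le_rpow_of_exponent_le one_le_two ?_
    refine mul_le_mul_of_nonneg_left ?_ (Nat.cast_nonneg n)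
    rw [hβ]; linarith
  have h3 : ∑' m : ℕ, J.dyadicTerm h Q q₂ A f (n + m) ≤ 2 * Cw * (1 - ρ)⁻¹ * ρ ^ n := by
    have s1 : HasSum (fun m : ℕ => 2 * Cw * ρ ^ (n + m)) (2 * Cw * ρ ^ n * (1 - ρ)⁻¹) := by
      simpa only [pow_add, mul_assoc] using
        (hasSum_geometric_of_lt_one hρ0.le hρ1).mul_left (2 * Cw * ρ ^ n)
    have s2 : Summable fun m : ℕ => J.dyadicTerm h Q q₂ A f (n + m) :=
      Summable.of_nonneg_of_le (fun m => J.dyadicTerm_nonneg h Q q₂ A f _)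
        (fun m => hterm _) s1.summable
    refine (s2.tsum_le_tsum (fun m => hterm _) s1.summable).trans (le_of_eq ?_)
    rw [s1.tsum_eq]; ring
  rw [hρn]
  refine (hb n x hx).trans ?_
  rw [mul_assoc C]
  gcongr C * ?_
  calc _ ≤ Cw * ρ ^ n + ‖f‖ * ρ ^ n * R + 2 * Cw * (1 - ρ)⁻¹ * ρ ^ n := by gcongr
    _ = _ := by ring

/-- A crude bound, taking `r = 1` and `G = ‖f‖`. Any polynomial growth is harmless, since the
multiplier `φ` is approximable at every polynomial rate. -/
theorem IsJointDataSpace.exists_norm_sigmaC_le {J : JointData X₁ X₂} {Q q₁ q₂ : ℝ}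
    (hJ : J.IsJointDataSpace Q q₁ q₂) {h : ℝ → ℝ} (hh : IsLowPassFilter h) {S : ℕ}
    (hS : q₂ < S) {c : ℝ} (hc : 0 < c) (f : C(X₂, ℝ)) :
    ∃ M : ℝ, 0 ≤ M ∧ ∀ m : ℕ, ‖J.sigmaC h (c * 2 ^ m) f‖ ≤ M * (2 ^ m : ℝ) ^ Q := by
  obtain ⟨C, hC, H⟩ := hJ.exists_sigma_bound hh hS hc
  have hq₂ := hJ.q₂_pos
  refine ⟨C * (c ^ (Q - q₂) * ‖f‖ + c ^ (Q - S) * ‖f‖), by positivity, fun m => ?_⟩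
  have hu1 : (1 : ℝ) ≤ 2 ^ m := one_le_pow₀ one_le_two
  have hu0 : (0 : ℝ) < 2 ^ m := by positivity
  refine (ContinuousMap.norm_le _ (by positivity)).2 fun x => ?_
  rw [Real.norm_eq_abs, J.sigmaC_apply hh (by positivity)]
  have h1 := H (c * 2 ^ m) 1 ‖f‖ f x (le_mul_of_one_le_right hc.le hu1) one_pos (norm_nonneg f)
    fun y _ => f.norm_coe_le_norm y
  rw [Real.one_rpow, mul_one, Real.mul_rpow hc.le hu0.le, Real.mul_rpow hc.le hu0.le] at h1
  have h2 : (2 ^ m : ℝ) ^ (Q - q₂) ≤ (2 ^ m : ℝ) ^ Q :=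
    Real.rpow_le_rpow_of_exponent_le hu1 (by linarith)
  have h3 : (2 ^ m : ℝ) ^ (Q - S) ≤ (2 ^ m : ℝ) ^ Q :=
    Real.rpow_le_rpow_of_exponent_le hu1 (by linarith)
  calc _ ≤ C * (c ^ (Q - q₂) * (2 ^ m : ℝ) ^ Q * ‖f‖ + c ^ (Q - S) * (2 ^ m : ℝ) ^ Q * ‖f‖) :=
        h1.trans (by gcongr)
    _ = _ := by ring

/-- As `φ` vanishes off `B`, the error bound on `B` becomes a global one for `φ ℰ(f) - φ
σ_{c2^m}(f)`. This gives continuity as a uniform limit and supplies the approximants for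
`mem_W_of_approx`. -/
theorem exists_mem_W_eq_mul_lift (J : JointData X₁ X₂) {h : ℝ → ℝ} (hh : IsLowPassFilter h)
    {B : Set X₁} {f : C(X₂, ℝ)} {c α β Q M M' : ℝ} (hc : 0 < c) (hα : 0 < α) (hβ : 0 < β)
    (hQ : 0 < Q) (hL : ∀ j k, J.Ξ₁.lam j ≤ α * J.L j k) (hprod : J.Ξ₁.StrongProduct)
    (hM : 0 ≤ M) (hM' : 0 ≤ M')
    (herr : ∀ n : ℕ, ∀ x ∈ B,
      |J.lift h f x - J.sigma h (c * 2 ^ n) f x| ≤ M * (2 ^ n : ℝ) ^ (-β))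
    (hnorm : ∀ m : ℕ, ‖J.sigmaC h (c * 2 ^ m) f‖ ≤ M' * (2 ^ m : ℝ) ^ Q)
    {φ : C(X₁, ℝ)} (hφ : φ ∈ J.Ξ₁.smoothOn B) :
    ∃ g ∈ J.Ξ₁.W β, ∀ x, g x = φ x * J.lift h f x := by
  set F : ℕ → C(X₁, ℝ) := fun m => J.sigmaC h (c * 2 ^ m) f with hF
  have hpt : ∀ (m : ℕ) (x : X₁), |φ x * J.lift h f x - (φ * F m) x| ≤
      ‖φ‖ * M * (2 ^ m : ℝ) ^ (-β) := by
    intro m x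
    rw [ContinuousMap.mul_apply, hF]
    simp only
    rw [J.sigmaC_apply hh (by positivity), ← mul_sub, abs_mul, mul_assoc]
    by_cases hx : φ x = 0
    · rw [hx, abs_zero, zero_mul]; positivity
    · have h1 : |φ x| ≤ ‖φ‖ := φ.norm_coe_le_norm x
      have h2 := herr m x (hφ.2 hx)
      gcongr
  have hlim : Tendsto (fun m : ℕ => ‖φ‖ * M * (2 ^ m : ℝ) ^ (-β)) atTop (𝓝 0) := by
    have h1 := ((tendsto_rpow_neg_atTop hβ).comp
      (tendsto_pow_atTop_atTop_of_one_lt (one_lt_two (α := ℝ)))).const_mul (‖φ‖ * M)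
    rw [mul_zero] at h1
    exact h1
  have hunif : TendstoUniformly (fun (m : ℕ) x => (φ * F m) x) (fun x => φ x * J.lift h f x)
      atTop := by
    rw [Metric.tendstoUniformly_iff]
    intro ε hε
    filter_upwards [hlim.eventually (gt_mem_nhds hε)] with m hm x
    rw [Real.dist_eq]
    exact (hpt m x).trans_lt hm
  set g : C(X₁, ℝ) := ⟨fun x => φ x * J.lift h f x,
    hunif.continuous (Eventually.of_forall fun m => (φ * F m).continuous).frequently⟩ with hg
  -- The strong product assumption is stated for integer orders, so the order `αc2^m` is enlarged to
  -- `K2^m`.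
  obtain ⟨K, hK⟩ := exists_nat_ge (max (α * c) 1)
  have hK1 : (1 : ℝ) ≤ K := (le_max_right _ _).trans hK
  have hKα : α * c ≤ K := (le_max_left _ _).trans hK
  refine ⟨g, hprod.mem_W_of_approx hφ.1 (F := F) (K := K) (η := Q) (M := ‖φ‖ * M + M')
    (by exact_mod_cast hK1) hβ hQ (fun m => ?_) (fun m => ?_) (fun m => ?_), fun x => rfl⟩
  · refine J.Ξ₁.diffPoly_mono ?_ (J.sigmaC_mem h hα hL _ f)
    rw [← mul_assoc]
    gcongr
  · refine (hnorm m).trans ?_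
    have : 0 ≤ ‖φ‖ * M := by positivity
    gcongr
    linarith
  · refine (ContinuousMap.norm_le _ (by positivity)).2 fun x => (hpt m x).trans ?_
    gcongr
    linarith

end JointData

end

/-! ### The main theorem -/

theorem theorem4p1 {X₁ X₂ : Type*}
    [MetricSpace X₁] [CompactSpace X₁] [MeasurableSpace X₁] [BorelSpace X₁]
    [MetricSpace X₂] [CompactSpace X₂] [MeasurableSpace X₂] [BorelSpace X₂]
    (h : ℝ → ℝ) (hh : IsLowPassFilter h)
    (J : JointData X₁ X₂) (Q q₁ q₂ : ℝ) (hJ : J.IsJointDataSpace Q q₁ q₂)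
    (S : ℕ) (hS : max Q (max q₁ q₂) + 1 < (S : ℝ))
    (c : ℝ) (hc : J.PolynomialPreservation h c)
    (hpu : J.Ξ₂.HasPartitionOfUnity) :
    -- the constant depends only on the joint data space, `h`, `S` and `c`
    ∃ C : ℝ, 0 < C ∧
      ∀ (r s : ℝ) (A : Set X₂) (B : Set X₁), 0 < r → 0 < s → IsCompact A →
        J.IsImageSet r s A B →
      ∀ f : C(X₂, ℝ), Summable (J.dyadicTerm h Q q₂ A f) →
        -- (a) existence of the lifted function on `B`
        TendstoUniformlyOn (fun n : ℝ => J.sigma h n f) (J.lift h f) atTop B ∧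
        -- (a) error bound in the supremum norm on `B`
        (∀ n : ℕ, 1 ≤ c * r * 2 ^ n → ∀ x ∈ B,
          |J.lift h f x - J.sigma h (c * 2 ^ n) f x| ≤
            C * ((2 : ℝ) ^ ((n : ℝ) * (Q - q₂)) *
                  supNormOn A (fun y => f y - J.Ξ₂.sigma h (2 ^ n) f y)
                + ‖f‖ * (2 : ℝ) ^ ((n : ℝ) * (Q - S)) * r ^ (q₂ - S)
                + ∑' m : ℕ, J.dyadicTerm h Q q₂ A f (n + m))) ∧
        -- (a) polynomial order of `σ_n`
        (∀ α : ℝ, 0 < α → (∀ j k, J.Ξ₁.lam j ≤ α * J.L j k) →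
          ∀ n : ℝ, 0 < n → ∃ P ∈ J.Ξ₁.diffPoly (α * n), ∀ x, P x = J.sigma h n f x) ∧
        -- (b)
        (∀ γ : ℝ, 0 < γ → Q - q₂ < γ → γ < S - q₂ → f ∈ J.Ξ₂.WOn γ A →
          ContinuousOn (J.lift h f) B ∧
          (J.Ξ₁.StrongProduct → J.Ξ₁.HasPartitionOfUnity →
            ∀ α : ℝ, 0 < α → (∀ j k, J.Ξ₁.lam j ≤ α * J.L j k) →
            ∀ φ ∈ J.Ξ₁.smoothOn B,
              ∃ g ∈ J.Ξ₁.W (γ - Q + q₂), ∀ x, g x = φ x * J.lift h f x)) := by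
  have hS₂ : q₂ < S := by
    have h1 : q₂ ≤ max Q (max q₁ q₂) := (le_max_right _ _).trans (le_max_right _ _)
    linarith
  have hSQ : Q < S := by linarith [le_max_left Q (max q₁ q₂)]
  obtain ⟨C, hC, H⟩ := hJ.exists_lift_bound hh hS₂ hSQ hc hpu
  refine ⟨C, hC, fun r s A B hr _ hA hB f hf => ?_⟩
  obtain ⟨hunif, hbound⟩ := H r s A B hr hB f hf
  refine ⟨hunif, fun n _ x hx => ?_, fun α hα hL n hn => ?_, fun γ hγ hγ₁ hγ₂ hfγ => ⟨?_, ?_⟩⟩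
  · have e : (fun y => f y - J.Ξ₂.sigma h (2 ^ n) f y) =
        (f - J.Ξ₂.sigmaC h (2 ^ n) f : C(X₂, ℝ)) := by
      ext y
      rw [ContinuousMap.sub_apply, J.Ξ₂.sigmaC_apply hh (by positivity)]
    rw [e]
    exact hbound n x hx
  · exact ⟨J.sigmaC h n f, J.sigmaC_mem h hα hL n f, J.sigmaC_apply hh hn f⟩
  · refine hunif.continuousOn (Eventually.frequently ?_)
    filter_upwards [eventually_gt_atTop 0] with n hn
    refine (J.sigmaC h n f).continuous.continuousOn.congr fun x _ => ?_
    exact (J.sigmaC_apply hh hn f x).symm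
  · intro hprod _ α hα hL φ hφ
    obtain ⟨M, hM, herr⟩ := J.exists_lift_error_rate hh hpu hC (by positivity) hγ hγ₁ hγ₂ hA hfγ
      hbound
    obtain ⟨M', hM', hnorm⟩ := hJ.exists_norm_sigmaC_le hh hS₂ hc.1 f
    exact J.exists_mem_W_eq_mul_lift hh hc.1 hα (by linarith) hJ.Q_pos hL hprod hM hM' herr
      hnorm hφ
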